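/- Theorem 2. Let $S^3\subset\mathbb R^4$ be the unit sphere with toroidal coordinates $x=\cos\chi\cos\theta,\ y=\cos\chi\sin\theta,\ z=\sin\chi\cos\varphi,\ w=\sin\chi\sin\varphi$ ($0\le\chi\le\pi/2$, $\theta,\varphi\in\mathbb R$), and with its round metric and volume $dV$. Let $p\ge 1$ and $q$ be integers, and let $L(p,q)$ be the quotient of $S^3$ by the cyclic group generated by $(\chi,\theta,\varphi)\mapsto(\chi,\theta+2\pi/p,\varphi+2\pi q/p)$, with the metric induced from $S^3$ (a lens space if $\gcd(p,q)=1$; otherwise, an orbifold). A function $f$ on $L(p,q)$ is identified with its lift, an invariant function on $S^3$; $f$ is smooth if its lift is, its Laplacian is the function whose lift is the Laplacian of the lift of $f$, and $\langle f,g\rangle=\int_{S^3} fg\,dV$, the integral being that of the lifts. For integers $k\ge 0$, $\ell$, $m$ with $|\ell|+|m|\le k$ and $\ell+m\equiv k\pmod 2$ put $d=(k-|\ell|-|m|)/2$ and $$\Psi_{k,\ell,m}(\chi,\theta,\varphi)=\frac{\cos^{|\ell|}\chi\,\sin^{|m|}\chi\;P_d^{(|m|,|\ell|)}(\cos 2\chi)\;\Theta_\ell(\theta)\,\Theta_m(\varphi)}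 {\sqrt{2^{\hat\ell+\hat m}}\;\pi\;\sqrt{\dfrac{(|\ell|+d)!\,(|m|+d)!}{2(k+1)\,d!\,(|\ell|+|m|+d)!}}},$$ where $\Theta_n(t)=\cos|n|t$ for $n\ge0$ and $\Theta_n(t)=\sin|n|t$ for $n<0$, $\hat n$ is $1$ if $n=0$ and $0$ otherwise, and $P_d^{(a,b)}(u)=2^{-d}\sum_{i=0}^d\binom{a+d}{i}\binom{b+d}{d-i}(u+1)^i(u-1)^{d-i}$ is the Jacobi polynomial. Then every eigenvalue of the Laplacian on smooth real functions on $L(p,q)$ has the form $-k(k+2)$ with an integer $k\ge0$, and for every integer $k\ge0$ the space of smooth real functions $f$ on $L(p,q)$ with $\nabla^2f=-k(k+2)f$ has a basis, orthonormal for $\langle\cdot,\cdot\rangle$, whose lifts to $S^3$ are exactly the following functions, where all index pairs $(\ell,m)$ are subject to $|\ell|+|m|\le k$ and $\ell+m\equiv k\pmod 2$: * $\Psi_{k,0,0}$ (if $k$ is even); * $\Psi_{k,\ell,0}$ and $\Psi_{k,-\ell,0}$ for $\ell>0$ with $\ell\equiv0\pmod p$; * $\Psi_{k,0,m}$ and $\Psi_{k,0,-m}$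 for $m>0$ with $qm\equiv0\pmod p$; * $\sqrt{\tfrac12}(\Psi_{k,\ell,m}+\Psi_{k,-\ell,-m})$ and $\sqrt{\tfrac12}(\Psi_{k,-\ell,m}-\Psi_{k,\ell,-m})$ for $\ell,m>0$ with $\ell\equiv qm\pmod p$; * $\sqrt{\tfrac12}(\Psi_{k,\ell,m}-\Psi_{k,-\ell,-m})$ and $\sqrt{\tfrac12}(\Psi_{k,-\ell,m}+\Psi_{k,\ell,-m})$ for $\ell,m>0$ with $\ell\equiv-qm\pmod p$. -/

import Mathlib

open scoped Manifold ContDiff Laplacian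

noncomputable section

namespace LensSpace

/-! ### The 3-sphere, its volume and its Laplacian -/

/-- Euclidean 4-space with coordinates `(x, y, z, w)`. -/
abbrev E4 : Type := EuclideanSpace ℝ (Fin 4)

/-- The unit 3-sphere in `E4`. -/
abbrev S3 : Type := Metric.sphere (0 : E4) 1

instance : Fact (Module.finrank ℝ E4 = 3 + 1) := ⟨by simp⟩

/-- The Riemannian volume measure of the round 3-sphere (total mass `2 π ^ 2`). -/
def vol3 : MeasureTheory.Measure S3 := (MeasureTheory.volume : MeasureTheory.Measure E4).toSphere

/-- Smooth real functions on the 3-sphere. -/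
def IsSmooth3 (F : S3 → ℝ) : Prop := ContMDiff (𝓡 3) 𝓘(ℝ, ℝ) ∞ F

/-- Radial projection of a nonzero vector to the sphere. -/
def radialProj (y : E4) (h : y ≠ 0) : S3 :=
  ⟨‖y‖⁻¹ • y, by simp [norm_smul, h]⟩

/-- The extension of a function on the sphere that is constant along rays. -/
def radialExt (F : S3 → ℝ) (y : E4) : ℝ :=
  open Classical in if h : y ≠ 0 then F (radialProj y h) else 0

/-- The Laplace-Beltrami operator of the round 3-sphere: the Euclidean Laplacian of the extension
that is constant along rays, restricted to the sphere. -/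
def sphereLaplacian (F : S3 → ℝ) (x : S3) : ℝ := Δ (radialExt F) (x : E4)

theorem radialExt_contDiffAt {F : S3 → ℝ} (hF : IsSmooth3 F) (x : S3) :
    ContDiffAt ℝ ∞ (radialExt F) (x : E4) := by
  let U : TopologicalSpace.Opens E4 := ⟨{0}ᶜ, isOpen_compl_singleton⟩
  have hx : (x : E4) ≠ 0 := ne_zero_of_mem_unit_sphere x
  let n : U → E4 := fun y => ‖(y : E4)‖⁻¹ • (y : E4)
  have hn : ContMDiff 𝓘(ℝ, E4) 𝓘(ℝ, E4) ∞ n := by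
    intro y
    have hy : (y : E4) ≠ 0 := y.2
    have h : ContDiffAt ℝ ∞ (fun z : E4 => ‖z‖⁻¹ • z) (y : E4) :=
      ((contDiffAt_norm ℝ hy).inv (norm_ne_zero_iff.2 hy)).smul contDiffAt_id
    exact contMDiffAt_subtype_iff.2 h.contMDiffAt
  have hn' : ∀ y, n y ∈ Metric.sphere (0 : E4) 1 := fun y => (radialProj y.1 y.2).2
  have hc : ContMDiff 𝓘(ℝ, E4) 𝓘(ℝ, ℝ) ∞
      (fun y : U => F (Set.codRestrict n (Metric.sphere (0 : E4) 1) hn' y)) :=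
    ContMDiff.comp (I' := 𝓡 3) hF (hn.codRestrict_sphere (n := 3) hn')
  have he : (fun y : U => F (Set.codRestrict n (Metric.sphere (0 : E4) 1) hn' y)) =
      fun y : U => radialExt F y := by
    funext y
    have hy : (y : E4) ≠ 0 := y.2
    simp only [radialExt, dif_pos hy]
    rfl
  rw [he] at hc
  exact (contMDiffAt_subtype_iff.1 (hc ⟨x, hx⟩)).contDiffAt

theorem laplacian_comp_isometry (L : E4 ≃ₗᵢ[ℝ] E4) (f : E4 → ℝ) (x : E4) :
    Δ (f ∘ L) x = Δ f (L x) := by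
  rw [InnerProductSpace.laplacian_eq_iteratedFDeriv_orthonormalBasis (f ∘ L)
    (EuclideanSpace.basisFun (Fin 4) ℝ),
    InnerProductSpace.laplacian_eq_iteratedFDeriv_orthonormalBasis f
    ((EuclideanSpace.basisFun (Fin 4) ℝ).map L)]
  refine Finset.sum_congr rfl fun i _ => ?_
  have := L.toContinuousLinearEquiv.iteratedFDerivWithin_comp_right f (s := Set.univ) (x := x)
    uniqueDiffOn_univ (Set.mem_univ _) 2
  rw [Set.preimage_univ, iteratedFDerivWithin_univ, iteratedFDerivWithin_univ] at this
  have h2 : (f ∘ L) = f ∘ L.toContinuousLinearEquiv := rfl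
  rw [h2, this]
  simp only [ContinuousMultilinearMap.compContinuousLinearMap_apply, OrthonormalBasis.map_apply]
  congr 1
  funext j
  fin_cases j <;> rfl

/-! ### Lens spaces -/

/-- The rotation of `E4` by the angle `a` in the `(x, y)`-plane and by `b` in the
`(z, w)`-plane. -/
def rot (a b : ℝ) : E4 ≃ₗᵢ[ℝ] E4 where
  toFun v := !₂[Real.cos a * v 0 - Real.sin a * v 1, Real.sin a * v 0 + Real.cos a * v 1,
    Real.cos b * v 2 - Real.sin b * v 3, Real.sin b * v 2 + Real.cos b * v 3]
  invFun v := !₂[Real.cos a * v 0 + Real.sin a * v 1, -Real.sin a * v 0 + Real.cos a * v 1,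
    Real.cos b * v 2 + Real.sin b * v 3, -Real.sin b * v 2 + Real.cos b * v 3]
  map_add' u v := by ext i; fin_cases i <;> simp <;> ring
  map_smul' c v := by ext i; fin_cases i <;> simp <;> ring
  left_inv v := by
    ext i
    fin_cases i <;> simp
    · linear_combination v 0 * Real.sin_sq_add_cos_sq a
    · linear_combination v 1 * Real.sin_sq_add_cos_sq a
    · linear_combination v 2 * Real.sin_sq_add_cos_sq b
    · linear_combination v 3 * Real.sin_sq_add_cos_sq b
  right_inv v := by
    ext i
    fin_cases i <;> simp
    · linear_combination v 0 * Real.sin_sq_add_cos_sq a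
    · linear_combination v 1 * Real.sin_sq_add_cos_sq a
    · linear_combination v 2 * Real.sin_sq_add_cos_sq b
    · linear_combination v 3 * Real.sin_sq_add_cos_sq b
  norm_map' v := by
    simp only [EuclideanSpace.norm_eq]
    congr 1
    simp [Fin.sum_univ_four]
    linear_combination (v 0 ^ 2 + v 1 ^ 2) * Real.sin_sq_add_cos_sq a +
      (v 2 ^ 2 + v 3 ^ 2) * Real.sin_sq_add_cos_sq b

/-- The permutation of the sphere induced by a linear isometry. -/
def spherePerm (L : E4 ≃ₗᵢ[ℝ] E4) : Equiv.Perm S3 where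
  toFun x := ⟨L x, by simp⟩
  invFun x := ⟨L.symm x, by simp⟩
  left_inv x := by simp
  right_inv x := by simp

/-- The isometry `(χ, θ, φ) ↦ (χ, θ + 2π/p, φ + 2πq/p)` of the 3-sphere. -/
def gen (p : ℕ) (q : ℤ) : Equiv.Perm S3 :=
  spherePerm (rot (2 * Real.pi / p) (2 * Real.pi * q / p))

/-- The lens space `L(p, q)`: the orbit space of the cyclic group generated by `gen p q`. -/
abbrev Lens (p : ℕ) (q : ℤ) : Type :=
  MulAction.orbitRel.Quotient (Subgroup.zpowers (gen p q)) S3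

/-- The projection of the 3-sphere onto the lens space. -/
def proj (p : ℕ) (q : ℤ) (x : S3) : Lens p q := Quotient.mk _ x

/-- The lift to the 3-sphere of a function on the lens space. -/
def lift {p : ℕ} {q : ℤ} (f : Lens p q → ℝ) (x : S3) : ℝ := f (proj p q x)

/-- Smooth functions on the lens space: the projection is a local diffeomorphism if `p` and `q` are
coprime, and if they are not, these are the smooth functions on the quotient orbifold. -/
def IsSmooth {p : ℕ} {q : ℤ} (f : Lens p q → ℝ) : Prop := IsSmooth3 (lift f)

theorem sphereLaplacian_isometry (L : E4 ≃ₗᵢ[ℝ] E4) (F : S3 → ℝ)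
    (hF : ∀ x, F (spherePerm L x) = F x) (x : S3) :
    sphereLaplacian F (spherePerm L x) = sphereLaplacian F x := by
  have h : radialExt F ∘ L = radialExt F := by
    funext y
    by_cases hy : y = 0
    · simp [radialExt, hy]
    · have hy' : L y ≠ 0 := by simpa using hy
      rw [Function.comp_apply, radialExt, radialExt, dif_pos hy, dif_pos hy',
        ← hF (radialProj y hy)]
      congr 1
      ext1
      simp [radialProj, spherePerm]
  have := laplacian_comp_isometry L (radialExt F) x
  rw [h] at this
  exact this.symm

theorem lift_gen {p : ℕ} {q : ℤ} (f : Lens p q → ℝ) (x : S3) :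
    lift f (gen p q x) = lift f x := by
  unfold lift proj
  congr 1
  exact Quotient.sound ⟨⟨gen p q, Subgroup.mem_zpowers _⟩, rfl⟩

theorem sphereLaplacian_lift_eq {p : ℕ} {q : ℤ} (f : Lens p q → ℝ) (x y : S3)
    (h : (MulAction.orbitRel (Subgroup.zpowers (gen p q)) S3).r x y) :
    sphereLaplacian (lift f) x = sphereLaplacian (lift f) y := by
  have key : ∀ z, sphereLaplacian (lift f) (gen p q z) = sphereLaplacian (lift f) z :=
    fun z => sphereLaplacian_isometry _ _ (fun w => lift_gen f w) z
  obtain ⟨⟨s, n, rfl⟩, rfl⟩ := h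
  change sphereLaplacian (lift f) ((gen p q ^ n) y) = _
  induction n with
  | zero => simp
  | succ n ih =>
    rw [add_comm, zpow_add, zpow_one]
    exact (key _).trans ih
  | pred n ih =>
    refine Eq.trans ?_ ih
    rw [← key, ← Equiv.Perm.mul_apply, ← zpow_one_add]
    congr 3
    ring

/-- The Laplace-Beltrami operator of `L(p, q)` for the metric that makes the projection from the
round 3-sphere a local isometry: near `proj p q x` a function on `L(p, q)` is identified with its
lift near `x`. -/
def lensLaplacian {p : ℕ} {q : ℤ} (f : Lens p q → ℝ) : Lens p q → ℝ :=
  Quotient.lift (sphereLaplacian (lift f)) (sphereLaplacian_lift_eq f)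

/-- The space of smooth real functions `f` on `L(p, q)` with `Δ f = c f`. -/
def eigenspace (p : ℕ) (q : ℤ) (c : ℝ) : Submodule ℝ (Lens p q → ℝ) where
  carrier := {f | IsSmooth f ∧ ∀ x, lensLaplacian f x = c * f x}
  zero_mem' := by
    refine ⟨contMDiff_const, ?_⟩
    rintro ⟨x⟩
    have : radialExt (lift (0 : Lens p q → ℝ)) = fun _ => 0 := by
      funext y
      simp [radialExt, lift]
    change Δ (radialExt (lift (0 : Lens p q → ℝ))) (x : E4) = c * 0
    rw [this, InnerProductSpace.laplacian_const]
    simp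
  add_mem' := by
    rintro f g ⟨hf, hf'⟩ ⟨hg, hg'⟩
    refine ⟨ContMDiff.add hf hg, ?_⟩
    rintro ⟨x⟩
    have : radialExt (lift (f + g)) = radialExt (lift f) + radialExt (lift g) := by
      funext y
      by_cases hy : y = 0 <;> simp [radialExt, lift, hy]
    have h1 : Δ (radialExt (lift f)) (x : E4) = c * f (proj p q x) := hf' (proj p q x)
    have h2 : Δ (radialExt (lift g)) (x : E4) = c * g (proj p q x) := hg' (proj p q x)
    change Δ (radialExt (lift (f + g))) (x : E4) = c * (f (proj p q x) + g (proj p q x))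
    rw [this, ContDiffAt.laplacian_add ((radialExt_contDiffAt hf x).of_le (by norm_cast))
      ((radialExt_contDiffAt hg x).of_le (by norm_cast)), h1, h2]
    ring
  smul_mem' := by
    rintro a f ⟨hf, hf'⟩
    refine ⟨(contDiff_const_smul a).contMDiff.comp hf, ?_⟩
    rintro ⟨x⟩
    have : radialExt (lift (a • f)) = a • radialExt (lift f) := by
      funext y
      by_cases hy : y = 0 <;> simp [radialExt, lift, hy]
    have h1 : Δ (radialExt (lift f)) (x : E4) = c * f (proj p q x) := hf' (proj p q x)
    change Δ (radialExt (lift (a • f))) (x : E4) = c * (a * f (proj p q x))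
    rw [this, InnerProductSpace.laplacian_smul a
      ((radialExt_contDiffAt hf x).of_le (by norm_cast)), h1]
    simp only [smul_eq_mul]
    ring

/-- The inner product of the lifts: the integral over the 3-sphere of their product. -/
def lensInner {p : ℕ} {q : ℤ} (f g : Lens p q → ℝ) : ℝ :=
  ∫ x, lift f x * lift g x ∂vol3

/-! ### Toroidal coordinates and the eigenmodes of the 3-sphere -/

/-- The point of the 3-sphere with toroidal coordinates `(χ, θ, φ)`. -/
def toroidal (χ θ φ : ℝ) : S3 :=
  ⟨!₂[Real.cos χ * Real.cos θ, Real.cos χ * Real.sin θ,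
    Real.sin χ * Real.cos φ, Real.sin χ * Real.sin φ], by
    have h : ‖(!₂[Real.cos χ * Real.cos θ, Real.cos χ * Real.sin θ,
        Real.sin χ * Real.cos φ, Real.sin χ * Real.sin φ] : E4)‖ ^ 2 = 1 := by
      rw [EuclideanSpace.norm_sq_eq]
      simp [Fin.sum_univ_four]
      linear_combination Real.cos χ ^ 2 * Real.sin_sq_add_cos_sq θ +
        Real.sin χ ^ 2 * Real.sin_sq_add_cos_sq φ + Real.sin_sq_add_cos_sq χ
    rw [mem_sphere_zero_iff_norm]
    exact (pow_eq_one_iff_of_nonneg (norm_nonneg _) two_ne_zero).1 h⟩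

/-- In toroidal coordinates the generator of the deck group is a translation. -/
theorem gen_toroidal (p : ℕ) (q : ℤ) (χ θ φ : ℝ) :
    gen p q (toroidal χ θ φ) =
      toroidal χ (θ + 2 * Real.pi / p) (φ + 2 * Real.pi * q / p) := by
  ext i
  fin_cases i <;>
    simp [gen, spherePerm, rot, toroidal, Real.cos_add, Real.sin_add] <;> ring

/-- The circular harmonic of integer index `n`: `cos (|n| t)` for `n ≥ 0`, `sin (|n| t)` for
`n < 0`. -/
def circ (n : ℤ) (t : ℝ) : ℝ :=
  if 0 ≤ n then Real.cos (n.natAbs * t) else Real.sin (n.natAbs * t)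

/-- The Jacobi polynomial `P_d^{(a, b)}` with natural number parameters. -/
def jacobi (a b d : ℕ) (u : ℝ) : ℝ :=
  1 / 2 ^ d * ∑ i ∈ Finset.range (d + 1),
    ((a + d).choose i : ℝ) * ((b + d).choose (d - i) : ℝ) * (u + 1) ^ i * (u - 1) ^ (d - i)

/-- The condition under which the eigenmode with indices `k, ℓ, m` exists. -/
def Admissible (k : ℕ) (l m : ℤ) : Prop :=
  |l| + |m| ≤ (k : ℤ) ∧ l + m ≡ k [ZMOD 2]

/-- `d = (k - (|ℓ| + |m|)) / 2`, an exact division of a nonnegative number for admissible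
indices. -/
def deg (k : ℕ) (l m : ℤ) : ℕ := (k - (l.natAbs + m.natAbs)) / 2

/-- The unnormalized eigenmode in toroidal coordinates. -/
def psiTilde (k : ℕ) (l m : ℤ) (χ θ φ : ℝ) : ℝ :=
  Real.cos χ ^ l.natAbs * Real.sin χ ^ m.natAbs *
    jacobi m.natAbs l.natAbs (deg k l m) (Real.cos (2 * χ)) * circ l θ * circ m φ

/-- The norm of `psiTilde k l m` in `L²` of the 3-sphere, for admissible indices. -/
def psiNorm (k : ℕ) (l m : ℤ) : ℝ :=
  √(2 ^ ((if l = 0 then 1 else 0) + (if m = 0 then 1 else 0) : ℕ)) * Real.pi *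
    √(((l.natAbs + deg k l m).factorial * (m.natAbs + deg k l m).factorial : ℝ) /
      (2 * (k + 1) * (deg k l m).factorial * (l.natAbs + m.natAbs + deg k l m).factorial))

/-- The normalized eigenmode `Ψ_{kℓm}` in toroidal coordinates. -/
def psi (k : ℕ) (l m : ℤ) (χ θ φ : ℝ) : ℝ := psiTilde k l m χ θ φ / psiNorm k l m

/-! ### The eigenbasis of the lens space -/

/-- The list of the basis vectors of `L(p, q)` with wave number `k`. In `lMode` and `mMode` the
nonzero index takes both signs; in the four last families the indices are positive. -/
inductive Mode (p : ℕ) (q : ℤ) (k : ℕ) : Type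
  | zero (h : Admissible k 0 0) : Mode p q k
  | lMode (l : ℤ) (hl : l ≠ 0) (h : Admissible k l 0) (hc : l ≡ 0 [ZMOD p]) : Mode p q k
  | mMode (m : ℤ) (hm : m ≠ 0) (h : Admissible k 0 m) (hc : q * m ≡ 0 [ZMOD p]) : Mode p q k
  | e1 (l m : ℤ) (hl : 0 < l) (hm : 0 < m) (h : Admissible k l m)
      (hc : l ≡ q * m [ZMOD p]) : Mode p q k
  | e2 (l m : ℤ) (hl : 0 < l) (hm : 0 < m) (h : Admissible k l m)
      (hc : l ≡ q * m [ZMOD p]) : Mode p q k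
  | e3 (l m : ℤ) (hl : 0 < l) (hm : 0 < m) (h : Admissible k l m)
      (hc : l ≡ -(q * m) [ZMOD p]) : Mode p q k
  | e4 (l m : ℤ) (hl : 0 < l) (hm : 0 < m) (h : Admissible k l m)
      (hc : l ≡ -(q * m) [ZMOD p]) : Mode p q k

/-- The lift of a basis vector to the 3-sphere, in toroidal coordinates. -/
def Mode.toFun {p : ℕ} {q : ℤ} {k : ℕ} (i : Mode p q k) (χ θ φ : ℝ) : ℝ :=
  match i with
  | .zero _ => psi k 0 0 χ θ φ
  | .lMode l _ _ _ => psi k l 0 χ θ φ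
  | .mMode m _ _ _ => psi k 0 m χ θ φ
  | .e1 l m _ _ _ _ => √(1 / 2) * (psi k l m χ θ φ + psi k (-l) (-m) χ θ φ)
  | .e2 l m _ _ _ _ => √(1 / 2) * (psi k (-l) m χ θ φ - psi k l (-m) χ θ φ)
  | .e3 l m _ _ _ _ => √(1 / 2) * (psi k l m χ θ φ - psi k (-l) (-m) χ θ φ)
  | .e4 l m _ _ _ _ => √(1 / 2) * (psi k (-l) m χ θ φ + psi k l (-m) χ θ φ)

end LensSpace

end

noncomputable section

namespace LensSpace

open MeasureTheory ComplexConjugate Polynomial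

/-! With the complex coordinates `Z = x + iy` and `W = z + iw`, every weight `(l, m)` and every `d`
give a polynomial `harm d l m`: a signed power of `Z` times one of `W` times a form of degree `d` in
`|Z|²` and `-|W|²` with Jacobi coefficients. It is harmonic (`laplacian_harm`) and homogeneous of
degree `k = |l| + |m| + 2d`, so its restriction to the sphere is an eigenfunction for `-k(k+2)`
(`sphereLaplacian_restrict`). In toroidal coordinates it is a function of `χ` times `exp(i(lθ +
mφ))` (`harm_toroidal`).

The generator of the deck group multiplies `harm d l m` by `exp(2πi(l + qm)/p)`, so this function
descends to the quotient exactly when `p ∣ l + qm`. Conjugation negates the weight, so the real and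
imaginary parts for weights in a half plane suffice. By the addition theorems for cosine and sine,
these parts are the listed combinations of the `Ψ`.

Orthogonality has two sources. Different weights are separated by the invariance of the volume under
rotations, different degrees by the symmetry of the Laplacian (`integral_mul_sphereLaplacian`). The
second source also yields the orthogonality of the Jacobi polynomials. The norm is therefore a
leading coefficient times the integral against one power of `|Z|²` (`integral_harm_mul_harm_neg`),
which is computed from moments.

For completeness, Stone–Weierstrass shows that a continuous function orthogonal to all `harm d l m`
is zero (`eq_zero_of_integral_mul_harm_eq_zero`). An eigenfunction on the quotient is automatically
orthogonal to those with another eigenvalue and to those that are not invariant, so it has to be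
tested only against the modes of its own `k` (`eq_zero_of_mem_eigenspace`). If its eigenvalue is no
`-k(k+2)`, nothing is left to test and the eigenfunction vanishes. Otherwise, subtracting the
projection onto the modes shows that they span. -/

/-! ### Partial derivatives and the Laplacian on `E4` -/

/-- The partial derivative in the `i`-th coordinate direction. -/
def pd {A : Type*} [NormedAddCommGroup A] [NormedSpace ℝ A] (i : Fin 4) (f : E4 → A) (y : E4) : A :=
  fderiv ℝ f y (EuclideanSpace.basisFun (Fin 4) ℝ i)

section Add

variable {A : Type*} [NormedAddCommGroup A] [NormedSpace ℝ A]

theorem pd_congr {f g : E4 → A} {y : E4} (i : Fin 4) (h : f =ᶠ[nhds y] g) :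
    pd i f y = pd i g y := by
  rw [pd, pd, h.fderiv_eq]

theorem contDiffAt_pd {f : E4 → A} {y : E4} {n m : WithTop ℕ∞} (hf : ContDiffAt ℝ n f y)
    (hmn : m + 1 ≤ n) (i : Fin 4) : ContDiffAt ℝ m (pd i f) y :=
  (hf.fderiv_right hmn).clm_apply contDiffAt_const

theorem laplacian_eq_sum_pd {f : E4 → A} {y : E4} (hf : ContDiffAt ℝ 2 f y) :
    Δ f y = ∑ i, pd i (pd i f) y := by
  rw [InnerProductSpace.laplacian_eq_iteratedFDeriv_orthonormalBasis f
    (EuclideanSpace.basisFun (Fin 4) ℝ)]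
  refine Finset.sum_congr rfl fun i _ => ?_
  have h : DifferentiableAt ℝ (fderiv ℝ f) y :=
    (hf.fderiv_right (m := 1) (by norm_num)).differentiableAt (by norm_num)
  rw [iteratedFDeriv_two_apply]
  simp only [Matrix.cons_val_zero, Matrix.cons_val_one]
  unfold pd
  rw [fderiv_clm_apply h (differentiableAt_const _)]
  simp

end Add

section Mul

variable {A : Type*} [NormedCommRing A] [NormedAlgebra ℝ A]

theorem pd_mul {f g : E4 → A} {y : E4} (i : Fin 4) (hf : DifferentiableAt ℝ f y)
    (hg : DifferentiableAt ℝ g y) :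
    pd i (fun x => f x * g x) y = f y * pd i g y + g y * pd i f y := by
  unfold pd
  rw [fderiv_fun_mul hf hg]
  simp

theorem laplacian_mul {f g : E4 → A} {y : E4} (hf : ContDiffAt ℝ 2 f y) (hg : ContDiffAt ℝ 2 g y) :
    Δ (fun x => f x * g x) y =
      f y * Δ g y + g y * Δ f y + 2 * ∑ i, pd i f y * pd i g y := by
  -- The product rule is needed on a whole neighbourhood, because it is differentiated once more.
  have ev : ∀ i, pd i (fun x => f x * g x) =ᶠ[nhds y]
      fun x => f x * pd i g x + g x * pd i f x := fun i => by
    filter_upwards [hf.eventually (by simp), hg.eventually (by simp)] with x hx hx'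
    exact pd_mul i (hx.differentiableAt (by norm_num)) (hx'.differentiableAt (by norm_num))
  have hf1 := hf.differentiableAt (by norm_num)
  have hg1 := hg.differentiableAt (by norm_num)
  have hfi : ∀ i, DifferentiableAt ℝ (pd i f) y := fun i =>
    (contDiffAt_pd (m := 1) hf (by norm_num) i).differentiableAt (by norm_num)
  have hgi : ∀ i, DifferentiableAt ℝ (pd i g) y := fun i =>
    (contDiffAt_pd (m := 1) hg (by norm_num) i).differentiableAt (by norm_num)
  rw [laplacian_eq_sum_pd (hf.mul hg), laplacian_eq_sum_pd hf, laplacian_eq_sum_pd hg,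
    Finset.mul_sum, Finset.mul_sum, Finset.mul_sum, ← Finset.sum_add_distrib,
    ← Finset.sum_add_distrib]
  refine Finset.sum_congr rfl fun i _ => ?_
  rw [pd_congr i (ev i)]
  have : pd i (fun x => f x * pd i g x + g x * pd i f x) y =
      pd i (fun x => f x * pd i g x) y + pd i (fun x => g x * pd i f x) y := by
    exact DFunLike.congr_fun (fderiv_fun_add (hf1.mul (hgi i)) (hg1.mul (hfi i))) _
  rw [this, pd_mul i hf1 (hgi i), pd_mul i hg1 (hfi i)]
  ring

end Mul

/-- Here `ρ'` has to be the derivative near `g y`, because it is differentiated again, while the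
second derivative is needed only at the point. -/
theorem laplacian_comp {g : E4 → ℝ} {ρ ρ' : ℝ → ℝ} {ρ'' : ℝ} {y : E4} (hg : ContDiffAt ℝ 2 g y)
    (hρ : ContDiffAt ℝ 2 ρ (g y)) (h1 : ∀ᶠ s in nhds (g y), HasDerivAt ρ (ρ' s) s)
    (h2 : HasDerivAt ρ' ρ'' (g y)) :
    Δ (fun x => ρ (g x)) y = ρ' (g y) * Δ g y + ρ'' * ∑ i, pd i g y ^ 2 := by
  have ev : ∀ i, pd i (fun x => ρ (g x)) =ᶠ[nhds y] fun x => ρ' (g x) * pd i g x := fun i => by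
    filter_upwards [hg.eventually (by simp), hg.continuousAt.eventually h1] with x hx hx'
    have := hx'.comp_hasFDerivAt x (hx.differentiableAt (by norm_num)).hasFDerivAt
    unfold pd
    have h3 : HasFDerivAt (fun x => ρ (g x)) (ρ' (g x) • fderiv ℝ g x) x := this
    rw [h3.fderiv]
    simp
  have hgi : ∀ i, DifferentiableAt ℝ (pd i g) y := fun i =>
    (contDiffAt_pd (m := 1) hg (by norm_num) i).differentiableAt (by norm_num)
  have hc : ContDiffAt ℝ 2 (fun x => ρ (g x)) y := hρ.comp y hg
  rw [laplacian_eq_sum_pd hc, laplacian_eq_sum_pd hg, Finset.mul_sum,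
    Finset.mul_sum, ← Finset.sum_add_distrib]
  refine Finset.sum_congr rfl fun i _ => ?_
  have h3 : HasFDerivAt (fun x => ρ' (g x)) (ρ'' • fderiv ℝ g y) y :=
    h2.comp_hasFDerivAt y (hg.differentiableAt (by norm_num)).hasFDerivAt
  rw [pd_congr i (ev i), pd_mul i h3.differentiableAt (hgi i)]
  congr 1
  unfold pd
  rw [h3.fderiv]
  simp
  ring

/-! ### Radial functions and functions that are constant along rays -/

theorem pd_norm_sq (i : Fin 4) (y : E4) : pd i (fun x : E4 => ‖x‖ ^ 2) y = 2 * y i := by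
  unfold pd
  rw [fderiv_norm_sq_apply]
  simp [EuclideanSpace.inner_eq_star_dotProduct]

theorem laplacian_norm_sq (y : E4) : Δ (fun x : E4 => ‖x‖ ^ 2) y = 8 := by
  rw [laplacian_eq_sum_pd (contDiff_norm_sq ℝ).contDiffAt]
  have : ∀ i, pd i (pd i fun x : E4 => ‖x‖ ^ 2) y = 2 := fun i => by
    have h : (pd i fun x : E4 => ‖x‖ ^ 2) = fun x => 2 * x i := funext (pd_norm_sq i)
    have h2 : HasFDerivAt (fun x : E4 => 2 * x i)
        ((2 : ℝ) • (EuclideanSpace.proj i : E4 →L[ℝ] ℝ)) y :=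
      (EuclideanSpace.proj i : E4 →L[ℝ] ℝ).hasFDerivAt.const_mul 2
    rw [h, pd, h2.fderiv]
    simp
  simp [this]
  norm_num

theorem sum_sq_eq (y : E4) : ∑ i, y i ^ 2 = ‖y‖ ^ 2 := by
  rw [EuclideanSpace.norm_sq_eq]
  simp

theorem sum_coord_mul_pd {f : E4 → ℝ} {y : E4} :
    ∑ i, y i * pd i f y = fderiv ℝ f y y := by
  have h : ∀ v, ∑ i, v i * pd i f y = fderiv ℝ f y v := fun v => by
    conv_rhs => rw [← (EuclideanSpace.basisFun (Fin 4) ℝ).sum_repr v]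
    simp [pd, map_sum]
  exact h y

theorem fderiv_eq_zero_of_constant_on_rays {f : E4 → ℝ} {y : E4}
    (h : ∀ r : ℝ, 0 < r → f (r • y) = f y) (hf : DifferentiableAt ℝ f y) :
    fderiv ℝ f y y = 0 := by
  have h1 : HasDerivAt (fun r : ℝ => r • y) y 1 := by
    simpa using (hasDerivAt_id (1 : ℝ)).smul_const y
  have hf' : HasFDerivAt f (fderiv ℝ f y) ((1 : ℝ) • y) := by simpa using hf.hasFDerivAt
  have h2 : HasDerivAt (fun r : ℝ => f (r • y)) (fderiv ℝ f y y) 1 :=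
    hf'.comp_hasDerivAt 1 h1
  have h3 : HasDerivAt (fun r : ℝ => f (r • y)) 0 1 := by
    refine (hasDerivAt_const 1 (f y)).congr_of_eventuallyEq ?_
    filter_upwards [lt_mem_nhds one_pos] with r hr using h r hr
  exact h2.unique h3

/-- The cross term of the product rule vanishes: the gradient of a radial function is parallel to
`y`, and the derivative of `f` along `y` is zero. -/
theorem laplacian_radial_mul {f : E4 → ℝ} {ρ : ℝ → ℝ} {y : E4}
    (h : ∀ r : ℝ, 0 < r → f (r • y) = f y) (hf : ContDiffAt ℝ 2 f y)
    (hρ : ContDiffAt ℝ 2 ρ (‖y‖ ^ 2)) :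
    Δ (fun x => ρ (‖x‖ ^ 2) * f x) y =
      ρ (‖y‖ ^ 2) * Δ f y + f y * Δ (fun x : E4 => ρ (‖x‖ ^ 2)) y := by
  have hN : ContDiffAt ℝ 2 (fun x : E4 => ‖x‖ ^ 2) y := (contDiff_norm_sq ℝ).contDiffAt
  have hη : ContDiffAt ℝ 2 (fun x : E4 => ρ (‖x‖ ^ 2)) y := hρ.comp y hN
  rw [laplacian_mul hη hf]
  have hd : HasDerivAt ρ (deriv ρ (‖y‖ ^ 2)) (‖y‖ ^ 2) :=
    (hρ.differentiableAt (by norm_num)).hasDerivAt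
  have h3 : HasFDerivAt (fun x : E4 => ρ (‖x‖ ^ 2))
      (deriv ρ (‖y‖ ^ 2) • fderiv ℝ (fun x : E4 => ‖x‖ ^ 2) y) y :=
    hd.comp_hasFDerivAt y (hN.differentiableAt (by norm_num)).hasFDerivAt
  have hp : ∀ i, pd i (fun x : E4 => ρ (‖x‖ ^ 2)) y * pd i f y =
      2 * deriv ρ (‖y‖ ^ 2) * (y i * pd i f y) := fun i => by
    have : pd i (fun x : E4 => ρ (‖x‖ ^ 2)) y = deriv ρ (‖y‖ ^ 2) * (2 * y i) := by
      rw [← pd_norm_sq, pd, h3.fderiv]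
      rfl
    rw [this]
    ring
  rw [Finset.sum_congr rfl fun i _ => hp i, ← Finset.mul_sum, sum_coord_mul_pd,
    fderiv_eq_zero_of_constant_on_rays h (hf.differentiableAt (by norm_num))]
  ring

/-- In dimension 4, `Δ rⁿ = n(n+2) rⁿ⁻²`. Writing `r` as the root of `‖x‖ ^ 2` makes this a
composition with a polynomial whose gradient and Laplacian are explicit. -/
theorem laplacian_norm_pow (n : ℕ) {y : E4} (hy : ‖y‖ = 1) :
    Δ (fun x : E4 => √(‖x‖ ^ 2) ^ n) y = n * (n + 2) := by
  have hN : ContDiffAt ℝ 2 (fun x : E4 => ‖x‖ ^ 2) y := (contDiff_norm_sq ℝ).contDiffAt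
  have hs : ∀ s : ℝ, 0 < s → HasDerivAt (fun s => √s ^ n) (n * √s ^ n / (2 * s)) s := by
    intro s hs
    refine ((Real.hasDerivAt_sqrt hs.ne').fun_pow n).congr_deriv ?_
    -- The power rule has the truncated exponent `n - 1`, so `n = 0` is separate.
    rcases n with _ | n
    · simp
    · have h0 : √s ≠ 0 := (Real.sqrt_pos.2 hs).ne'
      simp only [Nat.add_sub_cancel, pow_succ]
      field_simp
      rw [Real.sq_sqrt hs.le]
  have h2 : HasDerivAt (fun s : ℝ => n * √s ^ n / (2 * s)) ((n * (n - 2) : ℝ) / 4) (‖y‖ ^ 2) := by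
    rw [hy]
    have := ((hs 1 one_pos).const_mul (n : ℝ)).div ((hasDerivAt_id (1 : ℝ)).const_mul 2) (by simp)
    norm_num at this ⊢
    refine this.congr_deriv ?_
    ring
  rw [laplacian_comp (ρ := fun s => √s ^ n) (ρ' := fun s => n * √s ^ n / (2 * s)) hN ?_ ?_ h2,
    laplacian_norm_sq]
  · simp only [pd_norm_sq, mul_pow, ← Finset.mul_sum, sum_sq_eq, hy]
    norm_num
    ring
  · rw [hy]
    exact (Real.contDiffAt_sqrt (by norm_num)).pow n
  · filter_upwards [lt_mem_nhds (show (0 : ℝ) < ‖y‖ ^ 2 by simp [hy])] with s h using hs s h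

theorem radialExt_smul (F : S3 → ℝ) {r : ℝ} (hr : 0 < r) (y : E4) :
    radialExt F (r • y) = radialExt F y := by
  by_cases hy : y = 0
  · simp [hy]
  · have hy' : r • y ≠ 0 := smul_ne_zero hr.ne' hy
    rw [radialExt, radialExt, dif_pos hy, dif_pos hy']
    congr 1
    ext1
    simp only [radialProj, norm_smul, Real.norm_eq_abs, abs_of_pos hr, smul_smul]
    congr 1
    field_simp

theorem radialExt_coe (F : S3 → ℝ) (x : S3) : radialExt F x = F x := by
  have hx : (x : E4) ≠ 0 := ne_zero_of_mem_unit_sphere x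
  rw [radialExt, dif_pos hx]
  congr 1
  ext1
  simp [radialProj]

theorem radialExt_smul_coe (F : S3 → ℝ) {r : ℝ} (hr : 0 < r) (x : S3) :
    radialExt F (r • (x : E4)) = F x := by
  rw [radialExt_smul F hr, radialExt_coe]

theorem exists_smul_coe {y : E4} (hy : y ≠ 0) : ∃ r : ℝ, 0 < r ∧ ∃ x : S3, y = r • (x : E4) :=
  ⟨‖y‖, norm_pos_iff.2 hy, radialProj y hy, by simp [radialProj, hy]⟩

theorem radialExt_contDiffAt_of_ne {F : S3 → ℝ} (hF : IsSmooth3 F) {y : E4} (hy : y ≠ 0) :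
    ContDiffAt ℝ ∞ (radialExt F) y := by
  obtain ⟨r, hr, x, rfl⟩ := exists_smul_coe hy
  have h : radialExt F = radialExt F ∘ fun y => r⁻¹ • y := by
    funext y
    rw [Function.comp_apply, radialExt_smul F (inv_pos.2 hr)]
  rw [h]
  refine ContDiffAt.comp _ ?_ (contDiff_const_smul r⁻¹).contDiffAt
  rw [smul_smul, inv_mul_cancel₀ hr.ne', one_smul]
  exact radialExt_contDiffAt hF x

/-- The extension is homogeneous of degree 0, hence its second derivatives are homogeneous of degree
-2. -/
theorem laplacian_radialExt_smul {F : S3 → ℝ} (hF : IsSmooth3 F) {r : ℝ} (hr : 0 < r) (x : S3) :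
    Δ (radialExt F) (r • (x : E4)) = (r ^ 2)⁻¹ * sphereLaplacian F x := by
  have h : radialExt F = fun y => radialExt F (r • y) := by
    funext y
    rw [radialExt_smul F hr]
  have hp : ∀ i, pd i (radialExt F) = fun y => r * pd i (radialExt F) (r • y) := fun i => by
    funext y
    conv_lhs => rw [h]
    unfold pd
    rw [fderiv_comp_smul (f := radialExt F)]
    rfl
  have hx : (x : E4) ≠ 0 := ne_zero_of_mem_unit_sphere x
  have h2 : ∀ y : E4, y ≠ 0 → ContDiffAt ℝ 2 (radialExt F) y := fun y hy =>
    (radialExt_contDiffAt_of_ne hF hy).of_le (by norm_cast)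
  have hrx : r • (x : E4) ≠ 0 := smul_ne_zero hr.ne' hx
  rw [sphereLaplacian, laplacian_eq_sum_pd (h2 _ hx), laplacian_eq_sum_pd (h2 _ hrx),
    Finset.mul_sum]
  refine Finset.sum_congr rfl fun i _ => ?_
  have hd : DifferentiableAt ℝ (fun y => pd i (radialExt F) (r • y)) (x : E4) := by
    refine DifferentiableAt.comp (g := pd i (radialExt F)) (x : E4) ?_
      (differentiableAt_id.const_smul r)
    exact (contDiffAt_pd (m := 1) (h2 _ hrx) (by norm_num) i).differentiableAt (by norm_num)
  have : pd i (pd i (radialExt F)) (x : E4) = r ^ 2 * pd i (pd i (radialExt F)) (r • (x : E4)) := by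
    conv_lhs => rw [hp i]
    rw [pd, fderiv_const_mul hd, fderiv_comp_smul (f := pd i (radialExt F))]
    simp only [pd, smul_apply, smul_eq_mul]
    ring
  rw [this]
  field_simp

/-! ### Restrictions of homogeneous functions -/

theorem isSmooth3_restrict {u : E4 → ℝ} (hu : ContDiff ℝ ∞ u) : IsSmooth3 fun x : S3 => u x :=
  hu.contMDiff.comp (contMDiff_coe_sphere (n := 3))

/-- Away from the origin `u` is `‖y‖ⁿ` times the ray-constant extension of its restriction. By
`laplacian_radial_mul` its Laplacian on the sphere is the spherical Laplacian plus `n(n+2)u`. -/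
theorem sphereLaplacian_restrict {u : E4 → ℝ} (hu : ContDiff ℝ ∞ u) (n : ℕ)
    (hn : ∀ (r : ℝ) (y : E4), 0 < r → u (r • y) = r ^ n * u y) (x : S3) :
    sphereLaplacian (fun x : S3 => u x) x = Δ u (x : E4) - n * (n + 2) * u x := by
  set F : S3 → ℝ := fun x => u x with hF
  have hFs : IsSmooth3 F := isSmooth3_restrict hu
  have hx : ‖(x : E4)‖ = 1 := by simp
  have ev : u =ᶠ[nhds (x : E4)] fun y => √(‖y‖ ^ 2) ^ n * radialExt F y := by
    filter_upwards [isOpen_ne.mem_nhds (ne_zero_of_mem_unit_sphere x)] with y hy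
    obtain ⟨r, hr, x, rfl⟩ := exists_smul_coe hy
    rw [radialExt_smul_coe F hr, hn r _ hr, norm_smul]
    simp [abs_of_pos hr, Real.sqrt_sq hr.le, hF]
  have h1 : Δ u (x : E4) = Δ (fun y => √(‖y‖ ^ 2) ^ n * radialExt F y) (x : E4) :=
    (InnerProductSpace.laplacian_congr_nhds ev).eq_of_nhds
  rw [h1, laplacian_radial_mul (ρ := fun s => √s ^ n) (fun r hr => radialExt_smul F hr _)
    ((radialExt_contDiffAt hFs x).of_le (by norm_cast)), laplacian_norm_pow n hx, radialExt_coe, hx]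
  · simp [hF, sphereLaplacian]
    ring
  · rw [hx]
    exact (Real.contDiffAt_sqrt (by norm_num)).pow n

/-! ### Integration on the sphere -/

instance : IsFiniteMeasure vol3 := by unfold vol3; infer_instance

instance : vol3.IsOpenPosMeasure := by unfold vol3; infer_instance

theorem integrable_vol3 {A : Type*} [NormedAddCommGroup A] {F : S3 → A} (hF : Continuous F) :
    Integrable F vol3 := by
  rw [← integrableOn_univ]
  exact hF.continuousOn.integrableOn_compact isCompact_univ

theorem integral_polar {h : E4 → ℝ} {a : ℝ → ℝ} {F : S3 → ℝ}
    (hh : ∀ (r : ℝ) (x : S3), 0 < r → h (r • (x : E4)) = F x * a r) :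
    ∫ y, h y = (∫ x, F x ∂vol3) * ∫ r : Set.Ioi (0 : ℝ), a r ∂(Measure.volumeIoiPow 3) := by
  calc
    ∫ y, h y = ∫ y : ({(0)}ᶜ : Set E4), h y ∂((volume : Measure E4).comap (↑)) := by
      rw [integral_subtype_comap (measurableSet_singleton _).compl fun y ↦ h y,
        restrict_compl_singleton]
    _ = ∫ x, F x.1 * a x.2 ∂vol3.prod (.volumeIoiPow 3) := by
      have := ((volume : Measure E4).measurePreserving_homeomorphUnitSphereProd).integral_comp
        (Homeomorph.measurableEmbedding _) (fun x => F x.1 * a x.2)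
      rw [finrank_euclideanSpace_fin] at this
      rw [vol3, ← this]
      refine integral_congr_ae (.of_forall fun y => ?_)
      have hy : (y : E4) ≠ 0 := y.2
      have h0 : (0 : ℝ) < ‖(y : E4)‖ := norm_pos_iff.2 hy
      simp only [homeomorphUnitSphereProd_apply_snd_coe]
      rw [← hh _ _ h0]
      congr 1
      simp [smul_smul, h0.ne']
    _ = _ := integral_prod_mul F fun r : Set.Ioi (0 : ℝ) => a r

open scoped Pointwise in
-- The measure of `s` is a multiple of the volume of the cone over `s`, and a linear isometry maps
-- cones to cones and preserves volume.
theorem measurePreserving_spherePerm (L : E4 ≃ₗᵢ[ℝ] E4) :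
    MeasurePreserving (spherePerm L) vol3 vol3 := by
  have hc : Continuous (spherePerm L) :=
    Continuous.subtype_mk (L.continuous.comp continuous_subtype_val) _
  refine ⟨hc.measurable, ?_⟩
  ext s hs
  rw [Measure.map_apply hc.measurable hs, vol3, Measure.toSphere_apply' _ (hc.measurable hs),
    Measure.toSphere_apply' _ hs]
  congr 1
  rw [← L.measurePreserving.measure_preimage_emb L.toHomeomorph.measurableEmbedding
    (Set.Ioo (0 : ℝ) 1 • (Subtype.val '' s))]
  congr 1
  ext y
  simp only [Set.mem_smul, Set.mem_image, Set.mem_preimage]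
  constructor
  · rintro ⟨r, hr, _, ⟨x, hx, rfl⟩, rfl⟩
    exact ⟨r, hr, _, ⟨_, hx, rfl⟩, by simp [spherePerm]⟩
  · rintro ⟨r, hr, _, ⟨x, hx, rfl⟩, h⟩
    refine ⟨r, hr, _, ⟨(spherePerm L).symm x, by simpa using hx, rfl⟩, ?_⟩
    apply L.injective
    rw [← h]
    simp [spherePerm]

theorem integral_spherePerm {A : Type*} [NormedAddCommGroup A] [NormedSpace ℝ A]
    (L : E4 ≃ₗᵢ[ℝ] E4) (F : S3 → A) :
    ∫ x, F (spherePerm L x) ∂vol3 = ∫ x, F x ∂vol3 := by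
  refine (measurePreserving_spherePerm L).integral_comp ?_ F
  have hc : Continuous (spherePerm L) :=
    Continuous.subtype_mk (L.continuous.comp continuous_subtype_val) _
  exact hc.measurableEmbedding (spherePerm L).injective

theorem volume_sphere : vol3.real Set.univ = 2 * Real.pi ^ 2 := by
  rw [vol3, Measure.toSphere_real_apply_univ, finrank_euclideanSpace_fin, measureReal_def,
    EuclideanSpace.volume_ball]
  simp only [Fintype.card_fin]
  have h1 : Real.Gamma ((4 : ℕ) / 2 + 1 : ℝ) = 2 := by
    norm_num [Real.Gamma_ofNat_eq_factorial]
  have h2 : √Real.pi ^ 4 = Real.pi ^ 2 := by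
    rw [show 4 = 2 * 2 from rfl, pow_mul, Real.sq_sqrt Real.pi_pos.le]
  rw [h1, h2]
  simp only [ENNReal.ofReal_one, one_pow, one_mul]
  rw [ENNReal.toReal_ofReal (by positivity)]
  push_cast
  ring

/-! ### Symmetry of the Laplacian -/

theorem continuous_of_isSmooth3 {F : S3 → ℝ} (hF : IsSmooth3 F) : Continuous F :=
  ContMDiff.continuous hF

theorem continuous_sphereLaplacian {F : S3 → ℝ} (hF : IsSmooth3 F) :
    Continuous (sphereLaplacian F) := by
  rw [continuous_iff_continuousAt]
  intro x
  have hx : (x : E4) ≠ 0 := ne_zero_of_mem_unit_sphere x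
  have h : ContinuousAt (Δ (radialExt F)) (x : E4) := by
    have ev : Δ (radialExt F) =ᶠ[nhds (x : E4)] fun y => ∑ i, pd i (pd i (radialExt F)) y := by
      filter_upwards [isOpen_ne.mem_nhds hx] with y hy
      exact laplacian_eq_sum_pd ((radialExt_contDiffAt_of_ne hF hy).of_le (by norm_cast))
    rw [continuousAt_congr ev]
    refine tendsto_finsetSum _ fun i _ => ?_
    have h2 : ContDiffAt ℝ 2 (radialExt F) (x : E4) :=
      (radialExt_contDiffAt_of_ne hF hx).of_le (by norm_cast)
    exact (contDiffAt_pd (m := 0) (contDiffAt_pd (m := 1) h2 (by norm_num) i)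
      (by norm_num) i).continuousAt
  exact h.comp continuous_subtype_val.continuousAt

/-- A smooth bump function on the line, supported in `[1/2, 3/2]`. -/
def bump : ContDiffBump (1 : ℝ) := ⟨1 / 4, 1 / 2, by norm_num, by norm_num⟩

theorem bump_eq_zero_of_lt {s : ℝ} (hs : s < 1 / 2) : bump s = 0 := by
  apply bump.zero_of_le_dist
  change 1 / 2 ≤ dist s 1
  rw [Real.dist_eq, abs_of_neg (by linarith)]
  linarith

theorem bump_eq_zero_of_gt {s : ℝ} (hs : 2 < s) : bump s = 0 := by
  apply bump.zero_of_le_dist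
  change 1 / 2 ≤ dist s 1
  rw [Real.dist_eq, abs_of_pos (by linarith)]
  linarith

theorem eventually_bump_eq_zero : ∀ᶠ y : E4 in nhds 0, bump (‖y‖ ^ 2) = 0 := by
  have : Filter.Tendsto (fun y : E4 => ‖y‖ ^ 2) (nhds 0) (nhds 0) := by
    have h : Continuous fun y : E4 => ‖y‖ ^ 2 := by fun_prop
    simpa using h.tendsto (0 : E4)
  filter_upwards [this.eventually (gt_mem_nhds (show (0 : ℝ) < 1 / 2 by norm_num))] with y hy
  exact bump_eq_zero_of_lt hy

theorem hasCompactSupport_bump_mul (f : E4 → ℝ) :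
    HasCompactSupport fun y : E4 => bump (‖y‖ ^ 2) * f y := by
  refine HasCompactSupport.intro (isCompact_closedBall (0 : E4) 2) fun y hy => ?_
  rw [mem_closedBall_zero_iff, not_le] at hy
  rw [bump_eq_zero_of_gt (by nlinarith), zero_mul]

theorem contDiff_bump_mul {f : E4 → ℝ} (hf : ∀ y, y ≠ 0 → ContDiffAt ℝ ∞ f y) :
    ContDiff ℝ ∞ fun y : E4 => bump (‖y‖ ^ 2) * f y := by
  rw [contDiff_iff_contDiffAt]
  intro y
  by_cases hy : y = 0
  · subst hy
    refine (contDiffAt_const (c := (0 : ℝ))).congr_of_eventuallyEq ?_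
    filter_upwards [eventually_bump_eq_zero] with y hy
    rw [hy, zero_mul]
  · exact (bump.contDiff.comp (contDiff_norm_sq ℝ)).contDiffAt.mul (hf y hy)

theorem contDiffAt_inv_norm_sq {y : E4} (hy : y ≠ 0) :
    ContDiffAt ℝ ∞ (fun y : E4 => (‖y‖ ^ 2)⁻¹) y :=
  (contDiff_norm_sq ℝ).contDiffAt.inv (by simpa using hy)

/-- This is the radial factor that has to be cancelled in `integral_mul_sphereLaplacian`. By
`integral_polar` with `F = 1`, its vanishing would force the integral over `E4` of a continuous
nonnegative nonzero function to be zero. -/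
theorem radial_integral_ne_zero :
    ∫ r : Set.Ioi (0 : ℝ), bump (r.1 ^ 2) * (bump (r.1 ^ 2) * (r.1 ^ 2)⁻¹)
      ∂(Measure.volumeIoiPow 3) ≠ 0 := by
  have h := integral_polar (F := fun _ => 1)
    (h := fun y => bump (‖y‖ ^ 2) * (bump (‖y‖ ^ 2) * (‖y‖ ^ 2)⁻¹))
    (a := fun r => bump (r ^ 2) * (bump (r ^ 2) * (r ^ 2)⁻¹)) (by
      intro r x hr
      simp [norm_smul])
  intro h0
  rw [h0, mul_zero] at h
  have hc : Continuous fun y : E4 => bump (‖y‖ ^ 2) * (bump (‖y‖ ^ 2) * (‖y‖ ^ 2)⁻¹) :=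
    (contDiff_bump_mul fun y hy => (contDiff_bump_mul
      fun y hy => contDiffAt_inv_norm_sq hy).contDiffAt).continuous
  refine (hc.integral_pos_of_hasCompactSupport_nonneg_nonzero (μ := volume)
    (hasCompactSupport_bump_mul _) (fun y => ?_) (x := EuclideanSpace.single 0 1) ?_).ne' h
  · have := bump.nonneg (x := ‖y‖ ^ 2)
    positivity
  · have : bump 1 = 1 := bump.one_of_mem_closedBall (by simp [bump])
    simp [this]

/-- Symmetry is inherited from Euclidean space: cut off by a radial bump, the ray-constant
extensions become compactly supported smooth functions, for which the Euclidean Laplacian is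
symmetric. Polar coordinates then split off the integral over the sphere. -/
theorem integral_mul_sphereLaplacian {F G : S3 → ℝ} (hF : IsSmooth3 F) (hG : IsSmooth3 G) :
    ∫ x, F x * sphereLaplacian G x ∂vol3 = ∫ x, sphereLaplacian F x * G x ∂vol3 := by
  set η : E4 → ℝ := fun y => bump (‖y‖ ^ 2) with hη
  have cd : ∀ {F : S3 → ℝ}, IsSmooth3 F → ContDiff ℝ ∞ fun y => bump (‖y‖ ^ 2) * radialExt F y :=
    fun hF => contDiff_bump_mul fun y hy => radialExt_contDiffAt_of_ne hF hy
  have hΔ : ∀ {F : S3 → ℝ}, IsSmooth3 F → ∀ (r : ℝ) (x : S3), 0 < r →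
      Δ (fun y => bump (‖y‖ ^ 2) * radialExt F y) (r • (x : E4)) =
        bump (r ^ 2) * ((r ^ 2)⁻¹ * sphereLaplacian F x) + F x * Δ η (r • (x : E4)) := by
    intro F hF r x hr
    have hrx : r • (x : E4) ≠ 0 := smul_ne_zero hr.ne' (ne_zero_of_mem_unit_sphere x)
    rw [laplacian_radial_mul (fun r hr => radialExt_smul F hr _)
      ((radialExt_contDiffAt_of_ne hF hrx).of_le (by norm_cast)) bump.contDiff.contDiffAt,
      laplacian_radialExt_smul hF hr, radialExt_smul_coe F hr]
    simp [norm_smul, hη]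
  let u := (hasCompactSupport_bump_mul (radialExt F)).toSchwartzMap (cd hF)
  let v := (hasCompactSupport_bump_mul (radialExt G)).toSchwartzMap (cd hG)
  have hu : ⇑u = fun y => bump (‖y‖ ^ 2) * radialExt F y := rfl
  have hv : ⇑v = fun y => bump (‖y‖ ^ 2) * radialExt G y := rfl
  -- In this antisymmetric integrand the terms containing the Laplacian of the cutoff cancel; what
  -- remains is a function on the sphere times a function of the radius.
  have key : ∫ y, (u y * Δ v y - Δ u y * v y) = 0 := by
    rw [integral_sub, SchwartzMap.integral_mul_laplacian_right_eq_left, sub_self]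
    · exact (SchwartzMap.pairing (ContinuousLinearMap.mul ℝ ℝ) u (Δ v)).integrable
    · exact (SchwartzMap.pairing (ContinuousLinearMap.mul ℝ ℝ) (Δ u) v).integrable
  rw [integral_polar (F := fun x => F x * sphereLaplacian G x - sphereLaplacian F x * G x)
    (a := fun r => bump (r ^ 2) * (bump (r ^ 2) * (r ^ 2)⁻¹))] at key
  · have := (mul_eq_zero.1 key).resolve_right radial_integral_ne_zero
    rw [integral_sub] at this
    · linarith
    · exact integrable_vol3 ((continuous_of_isSmooth3 hF).mul (continuous_sphereLaplacian hG))
    · exact integrable_vol3 ((continuous_sphereLaplacian hF).mul (continuous_of_isSmooth3 hG))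
  · intro r x hr
    rw [SchwartzMap.laplacian_apply, SchwartzMap.laplacian_apply, hu, hv, hΔ hF r x hr,
      hΔ hG r x hr]
    beta_reduce
    rw [radialExt_smul_coe F hr, radialExt_smul_coe G hr]
    simp [norm_smul]
    ring

theorem integral_mul_eq_zero_of_eigenvalue_ne {F G : S3 → ℝ} (hF : IsSmooth3 F) (hG : IsSmooth3 G)
    {a b : ℝ} (hab : a ≠ b) (ha : ∀ x, sphereLaplacian F x = a * F x)
    (hb : ∀ x, sphereLaplacian G x = b * G x) : ∫ x, F x * G x ∂vol3 = 0 := by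
  have h := integral_mul_sphereLaplacian hF hG
  have h1 : ∫ x, F x * sphereLaplacian G x ∂vol3 = b * ∫ x, F x * G x ∂vol3 := by
    rw [← integral_const_mul]
    refine integral_congr_ae (.of_forall fun x => ?_)
    simp only [hb]
    ring
  have h2 : ∫ x, sphereLaplacian F x * G x ∂vol3 = a * ∫ x, F x * G x ∂vol3 := by
    rw [← integral_const_mul]
    refine integral_congr_ae (.of_forall fun x => ?_)
    simp only [ha]
    ring
  rw [h1, h2] at h
  have : (a - b) * ∫ x, F x * G x ∂vol3 = 0 := by linarith
  exact (mul_eq_zero.1 this).resolve_left (sub_ne_zero.2 hab)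

/-! ### Harmonic polynomials on `E4` -/

theorem laplacian_sum {ι A : Type*} [NormedAddCommGroup A] [NormedSpace ℝ A] (s : Finset ι)
    {f : ι → E4 → A} {y : E4} (hf : ∀ i ∈ s, ContDiffAt ℝ 2 (f i) y) :
    Δ (fun x => ∑ i ∈ s, f i x) y = ∑ i ∈ s, Δ (f i) y := by
  classical
  induction s using Finset.induction_on with
  | empty => simp [InnerProductSpace.laplacian_const]
  | insert i s hi ih =>
    have h1 : ContDiffAt ℝ 2 (f i) y := hf i (Finset.mem_insert_self i s)
    have h2 : ∀ j ∈ s, ContDiffAt ℝ 2 (f j) y := fun j hj => hf j (Finset.mem_insert_of_mem hj)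
    have h3 : ContDiffAt ℝ 2 (fun x => ∑ i ∈ s, f i x) y := ContDiffAt.sum h2
    have h4 : (fun x => ∑ i ∈ insert i s, f i x) = f i + fun x => ∑ i ∈ s, f i x := by
      funext x
      simp [Finset.sum_insert hi]
    rw [h4, h1.laplacian_add h3, Finset.sum_insert hi, ih h2]

theorem laplacian_const_mul (c : ℂ) {f : E4 → ℂ} {y : E4} (hf : ContDiffAt ℝ 2 f y) :
    Δ (fun x => c * f x) y = c * Δ f y :=
  InnerProductSpace.laplacian_smul c hf

/-- The coordinate vectors of `E4`. -/
abbrev e4 (i : Fin 4) : E4 := EuclideanSpace.basisFun (Fin 4) ℝ i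

theorem pd_clm_pow (L : E4 →L[ℝ] ℂ) (n : ℕ) (i : Fin 4) (y : E4) :
    pd i (fun x => L x ^ n) y = n * L y ^ (n - 1) * L (e4 i) := by
  unfold pd
  rw [fderiv_fun_pow n L.differentiableAt]
  simp

theorem contDiff_clm_pow (L : E4 →L[ℝ] ℂ) (n : ℕ) {k : WithTop ℕ∞} :
    ContDiff ℝ k fun x => L x ^ n := L.contDiff.pow n

/-- The Laplacian of `Lⁿ` is `n(n-1)Lⁿ⁻²` times the sum of the squared coefficients of `L`, so
powers of an isotropic form are harmonic. -/
theorem laplacian_clm_pow {L : E4 →L[ℝ] ℂ} (h : ∑ i, L (e4 i) ^ 2 = 0) (n : ℕ) (y : E4) :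
    Δ (fun x => L x ^ n) y = 0 := by
  rw [laplacian_eq_sum_pd (contDiff_clm_pow L n).contDiffAt]
  have : ∀ i, pd i (pd i fun x => L x ^ n) y =
      n * ((n - 1 : ℕ) * L y ^ (n - 1 - 1)) * L (e4 i) ^ 2 := fun i => by
    have h1 : (pd i fun x => L x ^ n) = fun x => (n * L (e4 i)) * L x ^ (n - 1) := by
      funext x
      rw [pd_clm_pow]
      ring
    have h2 := (contDiff_clm_pow L (n - 1) (k := 1)).contDiffAt (x := y)
    rw [h1, pd_mul i (differentiableAt_const _) (h2.differentiableAt (by norm_num)), pd_clm_pow]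
    simp [pd]
    ring
  rw [Finset.sum_congr rfl fun i _ => this i, ← Finset.mul_sum, h, mul_zero]

theorem laplacian_clm_pow_mul {L L' : E4 →L[ℝ] ℂ} (h : ∑ i, L (e4 i) ^ 2 = 0)
    (h' : ∑ i, L' (e4 i) ^ 2 = 0) (a b : ℕ) (y : E4) :
    Δ (fun x => L x ^ a * L' x ^ b) y =
      2 * (a * b * L y ^ (a - 1) * L' y ^ (b - 1)) * ∑ i, L (e4 i) * L' (e4 i) := by
  rw [laplacian_mul (contDiff_clm_pow L a).contDiffAt (contDiff_clm_pow L' b).contDiffAt,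
    laplacian_clm_pow h, laplacian_clm_pow h', mul_zero, mul_zero, zero_add, zero_add, Finset.mul_sum,
    Finset.mul_sum]
  refine Finset.sum_congr rfl fun i _ => ?_
  rw [pd_clm_pow, pd_clm_pow]
  ring

/-- The complex coordinate `x + i y` of `E4`. -/
def zCoord : E4 →L[ℝ] ℂ :=
  Complex.ofRealCLM.comp (EuclideanSpace.proj 0) +
    Complex.I • Complex.ofRealCLM.comp (EuclideanSpace.proj 1)

/-- The complex coordinate `z + i w` of `E4`. -/
def wCoord : E4 →L[ℝ] ℂ :=
  Complex.ofRealCLM.comp (EuclideanSpace.proj 2) +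
    Complex.I • Complex.ofRealCLM.comp (EuclideanSpace.proj 3)

theorem zCoord_apply (y : E4) : zCoord y = y 0 + Complex.I * y 1 := by
  simp [zCoord]

theorem wCoord_apply (y : E4) : wCoord y = y 2 + Complex.I * y 3 := by
  simp [wCoord]

/-- The complex conjugate of a complex-valued linear form. -/
def conjForm (L : E4 →L[ℝ] ℂ) : E4 →L[ℝ] ℂ := (Complex.conjCLE : ℂ →L[ℝ] ℂ).comp L

theorem conjForm_apply (L : E4 →L[ℝ] ℂ) (y : E4) : conjForm L y = conj (L y) := rfl

/-- The form itself for `n ≥ 0` and its conjugate for `n < 0`. -/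
def signForm (L : E4 →L[ℝ] ℂ) (n : ℤ) : E4 →L[ℝ] ℂ := if 0 ≤ n then L else conjForm L

/-- All four forms are isotropic, and `L`, `M` depend on disjoint pairs of coordinates, so only the
cross terms within each conjugate pair survive. Truncated exponents `a - 1` occur only with a factor
that is then zero. Letting `L` and `M` be conjugated covers all signs of the weights. -/
theorem laplacian_monomial {L M : E4 →L[ℝ] ℂ} (hL : L = zCoord ∨ L = conjForm zCoord)
    (hM : M = wCoord ∨ M = conjForm wCoord) (a b c e : ℕ) (y : E4) :
    Δ (fun x => L x ^ a * conjForm L x ^ b * (M x ^ c * conjForm M x ^ e)) y =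
      4 * (a * b * L y ^ (a - 1) * conjForm L y ^ (b - 1)) * (M y ^ c * conjForm M y ^ e) +
      4 * (c * e * M y ^ (c - 1) * conjForm M y ^ (e - 1)) *
        (L y ^ a * conjForm L y ^ b) := by
  have hz : (∑ i, L (e4 i) ^ 2 = 0 ∧ ∑ i, conjForm L (e4 i) ^ 2 = 0) ∧
      ∑ i, L (e4 i) * conjForm L (e4 i) = 2 := by
    rcases hL with rfl | rfl <;>
      simp [Fin.sum_univ_four, conjForm_apply, zCoord_apply] <;> norm_num
  have hw : (∑ i, M (e4 i) ^ 2 = 0 ∧ ∑ i, conjForm M (e4 i) ^ 2 = 0) ∧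
      ∑ i, M (e4 i) * conjForm M (e4 i) = 2 := by
    rcases hM with rfl | rfl <;>
      simp [Fin.sum_univ_four, conjForm_apply, wCoord_apply] <;> norm_num
  have hzero : L (e4 2) = 0 ∧ L (e4 3) = 0 ∧ M (e4 0) = 0 ∧ M (e4 1) = 0 := by
    rcases hL with rfl | rfl <;> rcases hM with rfl | rfl <;>
      simp [conjForm_apply, zCoord_apply, wCoord_apply]
  have cd : ∀ (N : E4 →L[ℝ] ℂ) (a b : ℕ),
      ContDiff ℝ 2 fun x => N x ^ a * conjForm N x ^ b := fun N a b =>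
    (contDiff_clm_pow N a).mul (contDiff_clm_pow _ b)
  have hp : ∀ (N : E4 →L[ℝ] ℂ) (a b : ℕ) (i : Fin 4), N (e4 i) = 0 →
      pd i (fun x => N x ^ a * conjForm N x ^ b) y = 0 := fun N a b i hi => by
    rw [pd_mul i ((contDiff_clm_pow N a (k := 1)).contDiffAt.differentiableAt (by norm_num))
      ((contDiff_clm_pow _ b (k := 1)).contDiffAt.differentiableAt (by norm_num)), pd_clm_pow,
      pd_clm_pow, conjForm_apply N (e4 i), hi]
    simp
  rw [laplacian_mul (cd L a b).contDiffAt (cd M c e).contDiffAt,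
    laplacian_clm_pow_mul hz.1.1 hz.1.2, laplacian_clm_pow_mul hw.1.1 hw.1.2, hz.2, hw.2,
    Fin.sum_univ_four, hp L a b 2 hzero.1, hp L a b 3 hzero.2.1, hp M c e 0 hzero.2.2.1,
    hp M c e 1 hzero.2.2.2]
  ring

/-- The signed power `z ^ n`, with the conjugate of `z` in place of `z⁻¹` for negative `n`. -/
def signPow (z : ℂ) (n : ℤ) : ℂ := if 0 ≤ n then z ^ n.natAbs else conj z ^ n.natAbs

/-- The coefficients of the Jacobi polynomials. -/
def jacobiCoeff (a b d i : ℕ) : ℝ := (a + d).choose i * (b + d).choose (d - i)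

/-- The harmonic polynomial of degree `|l| + |m| + 2 d` of weight `(l, m)`. -/
def harm (d : ℕ) (l m : ℤ) (y : E4) : ℂ :=
  signPow (zCoord y) l * signPow (wCoord y) m *
    ∑ i ∈ Finset.range (d + 1), (jacobiCoeff m.natAbs l.natAbs d i : ℂ) *
      (zCoord y * conj (zCoord y)) ^ i * (-(wCoord y * conj (wCoord y))) ^ (d - i)

theorem signPow_eq (L : E4 →L[ℝ] ℂ) (n : ℤ) (y : E4) :
    signPow (L y) n = signForm L n y ^ n.natAbs := by
  unfold signPow signForm
  split_ifs <;> rfl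

theorem signForm_mul_conj (L : E4 →L[ℝ] ℂ) (n : ℤ) (y : E4) :
    L y * conj (L y) = signForm L n y * conjForm (signForm L n) y := by
  unfold signForm
  split_ifs
  · rfl
  · simp [conjForm_apply, mul_comm]

theorem harm_eq_sum (d : ℕ) (l m : ℤ) : harm d l m = fun y =>
    ∑ i ∈ Finset.range (d + 1), ((jacobiCoeff m.natAbs l.natAbs d i : ℂ) * (-1) ^ (d - i)) *
      (signForm zCoord l y ^ (l.natAbs + i) * conjForm (signForm zCoord l) y ^ i *
        (signForm wCoord m y ^ (m.natAbs + (d - i)) *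
          conjForm (signForm wCoord m) y ^ (d - i))) := by
  funext y
  unfold harm
  rw [signPow_eq, signPow_eq, signForm_mul_conj zCoord l, signForm_mul_conj wCoord m,
    Finset.mul_sum]
  refine Finset.sum_congr rfl fun i _ => ?_
  rw [neg_pow (_ * _) (d - i), mul_pow, mul_pow, pow_add, pow_add]
  ring

theorem contDiff_harm (d : ℕ) (l m : ℤ) {n : WithTop ℕ∞} : ContDiff ℝ n (harm d l m) := by
  rw [harm_eq_sum]
  refine ContDiff.sum fun i _ => contDiff_const.mul ?_
  exact ((contDiff_clm_pow _ _).mul (contDiff_clm_pow _ _)).mul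
    ((contDiff_clm_pow _ _).mul (contDiff_clm_pow _ _))

/-- This recursion, a ratio of binomial coefficients, is exactly the cancellation condition in
`laplacian_harm`. -/
theorem jacobiCoeff_succ (a b : ℕ) {d i : ℕ} (hi : i < d) :
    jacobiCoeff a b d (i + 1) * ((b + (i + 1)) * (i + 1)) =
      jacobiCoeff a b d i * ((a + (d - i : ℕ)) * (d - i : ℕ)) := by
  obtain ⟨j, rfl⟩ : ∃ j, d = i + 1 + j := ⟨d - (i + 1), by omega⟩
  unfold jacobiCoeff
  have h1 := Nat.choose_succ_right_eq (a + (i + 1 + j)) i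
  have h2 := Nat.choose_succ_right_eq (b + (i + 1 + j)) j
  rw [show a + (i + 1 + j) - i = a + (j + 1) by omega] at h1
  rw [show b + (i + 1 + j) - j = b + (i + 1) by omega] at h2
  rw [show i + 1 + j - (i + 1) = j by omega, show i + 1 + j - i = j + 1 by omega]
  have h1' : ((a + (i + 1 + j)).choose (i + 1) : ℝ) * (i + 1) =
      (a + (i + 1 + j)).choose i * (a + (j + 1)) := by exact_mod_cast h1
  have h2' : ((b + (i + 1 + j)).choose (j + 1) : ℝ) * (j + 1) =
      (b + (i + 1 + j)).choose j * (b + (i + 1)) := by exact_mod_cast h2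
  push_cast
  linear_combination ((b + (i + 1 + j)).choose j : ℝ) * (b + (i + 1)) * h1' -
    ((a + (i + 1 + j)).choose i : ℝ) * (a + (j + 1)) * h2'

theorem laplacian_harm (d : ℕ) (l m : ℤ) (y : E4) : Δ (harm d l m) y = 0 := by
  have hL : signForm zCoord l = zCoord ∨ signForm zCoord l = conjForm zCoord := by
    unfold signForm
    split_ifs <;> simp
  have hM : signForm wCoord m = wCoord ∨ signForm wCoord m = conjForm wCoord := by
    unfold signForm
    split_ifs <;> simp
  rw [harm_eq_sum]
  set L := signForm zCoord l
  set M := signForm wCoord m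
  set a := l.natAbs
  set b := m.natAbs
  have cd : ∀ i j k n : ℕ, ContDiffAt ℝ 2
      (fun y => L y ^ i * conjForm L y ^ j * (M y ^ k * conjForm M y ^ n)) y := fun i j k n =>
    (((contDiff_clm_pow _ _).mul (contDiff_clm_pow _ _)).mul
      ((contDiff_clm_pow _ _).mul (contDiff_clm_pow _ _))).contDiffAt
  rw [laplacian_sum _ fun i _ => contDiffAt_const.mul (cd _ _ _ _)]
  simp_rw [fun i => laplacian_const_mul ((jacobiCoeff b a d i : ℂ) * (-1) ^ (d - i))
    (cd (a + i) i (b + (d - i)) (d - i)), laplacian_monomial hL hM, mul_add,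
    Finset.sum_add_distrib]
  -- The sum telescopes: the part of term `i + 1` with a lowered power of `|Z|²` and the part of
  -- term `i` with a lowered power of `|W|²` are the same monomial. The two unpaired parts, at `i =
  -- 0` and `i = d`, have coefficient zero.
  rw [Finset.sum_range_succ', Finset.sum_range_succ]
  simp only [Nat.cast_zero, mul_zero, zero_mul, add_zero, Nat.sub_self]
  rw [← Finset.sum_add_distrib]
  refine Finset.sum_eq_zero fun i hi => ?_
  have hid : i < d := Finset.mem_range.1 hi
  have hj := jacobiCoeff_succ b a hid
  obtain ⟨j, rfl⟩ : ∃ j, d = i + 1 + j := ⟨d - (i + 1), by omega⟩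
  have hj' : (jacobiCoeff b a (i + 1 + j) (i + 1) : ℂ) * ((a + (i + 1)) * (i + 1)) =
      jacobiCoeff b a (i + 1 + j) i * ((b + (i + 1 + j - i : ℕ)) * (i + 1 + j - i : ℕ)) := by
    exact_mod_cast congrArg (fun r : ℝ => (r : ℂ)) hj
  rw [show i + 1 + j - i = j + 1 by omega] at hj' ⊢
  rw [show i + 1 + j - (i + 1) = j by omega]
  simp only [← add_assoc, Nat.add_sub_cancel]
  push_cast at hj' ⊢
  linear_combination 4 * (-1) ^ j * L y ^ (a + i) * conjForm L y ^ i *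
    (M y ^ (b + j) * conjForm M y ^ j) * hj'

theorem harm_smul (d : ℕ) (l m : ℤ) (r : ℝ) (y : E4) :
    harm d l m (r • y) = (r : ℂ) ^ (l.natAbs + m.natAbs + 2 * d) * harm d l m y := by
  rw [harm_eq_sum]
  simp only [map_smul, Complex.real_smul, mul_pow, Finset.mul_sum]
  refine Finset.sum_congr rfl fun i hi => ?_
  have hid : i ≤ d := Nat.lt_succ_iff.1 (Finset.mem_range.1 hi)
  have : (r : ℂ) ^ (l.natAbs + m.natAbs + 2 * d) = (r : ℂ) ^ (l.natAbs + i) * (r : ℂ) ^ i *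
      ((r : ℂ) ^ (m.natAbs + (d - i)) * (r : ℂ) ^ (d - i)) := by
    rw [← pow_add, ← pow_add, ← pow_add]
    congr 1
    omega
  rw [this]
  ring

/-! ### Symmetries of the harmonic polynomials -/

theorem signPow_neg (z : ℂ) (n : ℤ) : signPow z (-n) = conj (signPow z n) := by
  unfold signPow
  rcases lt_trichotomy n 0 with h | rfl | h
  · rw [if_pos (by omega), if_neg (by omega)]
    simp
  · simp
  · rw [if_neg (by omega), if_pos (by omega)]
    simp

theorem harm_neg (d : ℕ) (l m : ℤ) (y : E4) : harm d (-l) (-m) y = conj (harm d l m y) := by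
  unfold harm
  simp only [signPow_neg, Int.natAbs_neg, map_mul, map_sum, map_pow, map_neg, Complex.conj_conj,
    Complex.conj_ofReal]
  congr 1
  refine Finset.sum_congr rfl fun i _ => ?_
  ring

theorem signPow_exp_mul (a : ℝ) (z : ℂ) (n : ℤ) :
    signPow (Complex.exp (a * Complex.I) * z) n =
      Complex.exp ((n * a : ℝ) * Complex.I) * signPow z n := by
  unfold signPow
  split_ifs with h
  · rw [mul_pow, ← Complex.exp_nat_mul]
    congr 2
    have : (n : ℂ) = n.natAbs := by
      conv_lhs => rw [← Int.natAbs_of_nonneg h]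
      simp
    push_cast
    rw [this]
    ring
  · rw [map_mul, mul_pow, ← Complex.exp_conj, ← Complex.exp_nat_mul]
    congr 2
    have : (n : ℂ) = -n.natAbs := by
      have h2 : n = -(n.natAbs : ℤ) := by omega
      conv_lhs => rw [h2]
      simp
    push_cast
    rw [this]
    simp
    ring

theorem zCoord_rot (a b : ℝ) (y : E4) :
    zCoord (rot a b y) = Complex.exp (a * Complex.I) * zCoord y := by
  rw [zCoord_apply, zCoord_apply, Complex.exp_mul_I, ← Complex.ofReal_cos, ← Complex.ofReal_sin]
  apply Complex.ext <;> simp [rot]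
  ring

theorem wCoord_rot (a b : ℝ) (y : E4) :
    wCoord (rot a b y) = Complex.exp (b * Complex.I) * wCoord y := by
  rw [wCoord_apply, wCoord_apply, Complex.exp_mul_I, ← Complex.ofReal_cos, ← Complex.ofReal_sin]
  apply Complex.ext <;> simp [rot]
  ring

theorem exp_mul_conj (a : ℝ) (z : ℂ) :
    Complex.exp (a * Complex.I) * z * conj (Complex.exp (a * Complex.I) * z) = z * conj z := by
  rw [map_mul, ← Complex.exp_conj]
  have : Complex.exp (a * Complex.I) * Complex.exp (conj ((a : ℂ) * Complex.I)) = 1 := by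
    rw [← Complex.exp_add]
    simp
  linear_combination z * conj z * this

theorem harm_rot (d : ℕ) (l m : ℤ) (a b : ℝ) (y : E4) :
    harm d l m (rot a b y) = Complex.exp ((l * a + m * b : ℝ) * Complex.I) * harm d l m y := by
  unfold harm
  rw [zCoord_rot, wCoord_rot, signPow_exp_mul, signPow_exp_mul, exp_mul_conj, exp_mul_conj,
    Complex.ofReal_add, add_mul, Complex.exp_add]
  ring

/-! ### Orthogonality of the harmonic polynomials -/

theorem continuous_harm (d : ℕ) (l m : ℤ) : Continuous fun x : S3 => harm d l m x :=
  (contDiff_harm d l m (n := 0)).continuous.comp continuous_subtype_val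

theorem isSmooth3_clm_harm (Λ : ℂ →L[ℝ] ℝ) (d : ℕ) (l m : ℤ) :
    IsSmooth3 fun x : S3 => Λ (harm d l m x) :=
  isSmooth3_restrict (u := fun y => Λ (harm d l m y)) (Λ.contDiff.comp (contDiff_harm d l m))

/-- The spherical Laplacian acts on real functions; an arbitrary real-linear `Λ` treats real parts,
imaginary parts and their multiples at once. -/
theorem sphereLaplacian_clm_harm (Λ : ℂ →L[ℝ] ℝ) (d : ℕ) (l m : ℤ) {k : ℕ}
    (hk : k = l.natAbs + m.natAbs + 2 * d) (x : S3) :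
    sphereLaplacian (fun x : S3 => Λ (harm d l m x)) x = -((k : ℝ) * (k + 2)) * Λ (harm d l m x) := by
  rw [sphereLaplacian_restrict (u := fun y => Λ (harm d l m y))
    (Λ.contDiff.comp (contDiff_harm d l m)) k]
  · have h : Δ (fun y => Λ (harm d l m y)) (x : E4) = Λ (Δ (harm d l m) (x : E4)) :=
      (contDiff_harm d l m).contDiffAt.laplacian_CLM_comp_left
    rw [h, laplacian_harm, map_zero]
    ring
  · intro r y _
    rw [harm_smul, ← hk, ← Complex.ofReal_pow, ← Complex.real_smul, map_smul, smul_eq_mul]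

theorem integral_mul_harm_eq_zero {F : S3 → ℝ} (hF : IsSmooth3 F) {c : ℝ}
    (hc : ∀ x, sphereLaplacian F x = c * F x) (d : ℕ) (l m : ℤ) {k : ℕ}
    (hk : k = l.natAbs + m.natAbs + 2 * d) (hck : c ≠ -((k : ℝ) * (k + 2))) :
    ∫ x : S3, (F x : ℂ) * harm d l m x ∂vol3 = 0 := by
  have hi : Integrable (fun x : S3 => (F x : ℂ) * harm d l m x) vol3 :=
    integrable_vol3 ((Complex.continuous_ofReal.comp (continuous_of_isSmooth3 hF)).mul
      (continuous_harm d l m))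
  have key : ∀ Λ : ℂ →L[ℝ] ℝ, Λ (∫ x : S3, (F x : ℂ) * harm d l m x ∂vol3) = 0 := fun Λ => by
    rw [← Λ.integral_comp_comm hi]
    have h := integral_mul_eq_zero_of_eigenvalue_ne hF (isSmooth3_clm_harm Λ d l m) hck hc
      (sphereLaplacian_clm_harm Λ d l m hk)
    rw [← h]
    refine integral_congr_ae (.of_forall fun x => ?_)
    simp only
    rw [← Complex.real_smul, map_smul, smul_eq_mul]
  exact Complex.ext (key Complex.reCLM) (key Complex.imCLM)

theorem eigenvalue_injective {k k' : ℕ} (h : -((k : ℝ) * (k + 2)) = -((k' : ℝ) * (k' + 2))) :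
    k = k' := by
  have h1 : ((k : ℝ) - k') * (k + k' + 2) = 0 := by linarith
  have h2 : (k : ℝ) + k' + 2 ≠ 0 := by positivity
  have h3 : (k : ℝ) = k' := by linarith [(mul_eq_zero.1 h1).resolve_right h2]
  exact_mod_cast h3

theorem integral_harm_mul_harm_of_degree_ne {d d' : ℕ} {l m l' m' : ℤ}
    (h : l.natAbs + m.natAbs + 2 * d ≠ l'.natAbs + m'.natAbs + 2 * d') :
    ∫ x : S3, harm d l m x * harm d' l' m' x ∂vol3 = 0 := by
  have hΛ : ∀ Λ : ℂ →L[ℝ] ℝ, ∫ x : S3, (Λ (harm d l m x) : ℂ) * harm d' l' m' x ∂vol3 = 0 :=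
    fun Λ => integral_mul_harm_eq_zero (isSmooth3_clm_harm Λ d l m)
      (sphereLaplacian_clm_harm Λ d l m rfl) d' l' m' rfl fun he => h (eigenvalue_injective he)
  have hi : ∀ Λ : ℂ →L[ℝ] ℝ,
      Integrable (fun x : S3 => (Λ (harm d l m x) : ℂ) * harm d' l' m' x) vol3 := fun Λ =>
    integrable_vol3 ((Complex.continuous_ofReal.comp
      (Λ.continuous.comp (continuous_harm d l m))).mul (continuous_harm d' l' m'))
  have : ∀ x : S3, harm d l m x * harm d' l' m' x =
      (Complex.reCLM (harm d l m x) : ℂ) * harm d' l' m' x +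
        Complex.I * ((Complex.imCLM (harm d l m x) : ℂ) * harm d' l' m' x) := fun x => by
    conv_lhs => rw [← Complex.re_add_im (harm d l m x)]
    simp only [Complex.reCLM_apply, Complex.imCLM_apply]
    ring
  rw [integral_congr_ae (.of_forall this), integral_add (hi _) ((hi _).const_mul _), hΛ,
    integral_const_mul, hΛ]
  simp

theorem exists_rotation_ne_one {l m : ℤ} (h : l ≠ 0 ∨ m ≠ 0) :
    ∃ a b : ℝ, Complex.exp ((l * a + m * b : ℝ) * Complex.I) ≠ 1 := by
  have key : Complex.exp ((Real.pi : ℝ) * Complex.I) ≠ 1 := by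
    rw [Complex.exp_pi_mul_I]
    norm_num
  rcases h with h | h
  · refine ⟨Real.pi / l, 0, ?_⟩
    have : (l : ℝ) ≠ 0 := by exact_mod_cast h
    rwa [mul_div_cancel₀ _ this, mul_zero, add_zero]
  · refine ⟨0, Real.pi / m, ?_⟩
    have : (m : ℝ) ≠ 0 := by exact_mod_cast h
    rwa [mul_div_cancel₀ _ this, mul_zero, zero_add]

/-- A rotation multiplies the integrand by a phase but preserves the integral; for suitable angles
the phase is `-1`. The pairing is bilinear, without conjugate, hence the sums of the weights. -/
theorem integral_harm_mul_harm_of_weight_ne {l m l' m' : ℤ} (d d' : ℕ)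
    (h : l + l' ≠ 0 ∨ m + m' ≠ 0) :
    ∫ x : S3, harm d l m x * harm d' l' m' x ∂vol3 = 0 := by
  obtain ⟨a, b, hab⟩ := exists_rotation_ne_one h
  have h1 := integral_spherePerm (rot a b) fun x : S3 => harm d l m x * harm d' l' m' x
  have h2 : ∀ x : S3, harm d l m (spherePerm (rot a b) x) * harm d' l' m' (spherePerm (rot a b) x) =
      Complex.exp (((l + l' : ℤ) * a + (m + m' : ℤ) * b : ℝ) * Complex.I) *
        (harm d l m x * harm d' l' m' x) := fun x => by
    have : ((spherePerm (rot a b) x : S3) : E4) = rot a b x := rfl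
    rw [this, harm_rot, harm_rot]
    have he : (((l + l' : ℤ) * a + (m + m' : ℤ) * b : ℝ) : ℂ) * Complex.I =
      (l * a + m * b : ℝ) * Complex.I + (l' * a + m' * b : ℝ) * Complex.I := by
      push_cast
      ring
    rw [he, Complex.exp_add]
    ring
  rw [integral_congr_ae (.of_forall h2), integral_const_mul] at h1
  exact (mul_eq_zero.1 (sub_eq_zero.2 h1 ▸ by ring :
    (Complex.exp (((l + l' : ℤ) * a + (m + m' : ℤ) * b : ℝ) * Complex.I) - 1) *
      ∫ x : S3, harm d l m x * harm d' l' m' x ∂vol3 = 0)).resolve_left (sub_ne_zero.2 hab)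

/-! ### Moments -/

/-- The squared distance to the plane `x = y = 0`. -/
def zSq (y : E4) : ℝ := y 0 ^ 2 + y 1 ^ 2

/-- The squared distance to the plane `z = w = 0`. -/
def wSq (y : E4) : ℝ := y 2 ^ 2 + y 3 ^ 2

theorem zCoord_mul_conj (y : E4) : zCoord y * conj (zCoord y) = zSq y := by
  rw [zCoord_apply, zSq]
  apply Complex.ext <;> simp [pow_two]
  ring

theorem wCoord_mul_conj (y : E4) : wCoord y * conj (wCoord y) = wSq y := by
  rw [wCoord_apply, wSq]
  apply Complex.ext <;> simp [pow_two]
  ring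

theorem zSq_add_wSq (x : S3) : zSq x + wSq x = 1 := by
  have h : ‖(x : E4)‖ ^ 2 = 1 := by simp
  rw [← sum_sq_eq, Fin.sum_univ_four] at h
  unfold zSq wSq
  linarith

theorem wSq_eq (x : S3) : wSq x = 1 - zSq x := by linarith [zSq_add_wSq x]

theorem contDiff_zSq {n : WithTop ℕ∞} : ContDiff ℝ n zSq := by
  unfold zSq
  fun_prop

theorem continuous_zSq : Continuous fun x : S3 => zSq x :=
  (contDiff_zSq (n := 0)).continuous.comp continuous_subtype_val

theorem laplacian_zSq_pow (n : ℕ) (y : E4) :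
    Δ (fun y => zSq y ^ n) y = 4 * n ^ 2 * zSq y ^ (n - 1) := by
  have h : (fun y => zSq y ^ n) = Complex.reCLM ∘ fun y =>
      zCoord y ^ n * conjForm zCoord y ^ n * (wCoord y ^ 0 * conjForm wCoord y ^ 0) := by
    funext y
    rw [Function.comp_apply, ← mul_pow, conjForm_apply, zCoord_mul_conj]
    simp [← Complex.ofReal_pow]
  have cd : ContDiffAt ℝ 2 (fun y =>
      zCoord y ^ n * conjForm zCoord y ^ n * (wCoord y ^ 0 * conjForm wCoord y ^ 0)) y :=
    (((contDiff_clm_pow _ _).mul (contDiff_clm_pow _ _)).mul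
      ((contDiff_clm_pow _ _).mul (contDiff_clm_pow _ _))).contDiffAt
  rw [h, cd.laplacian_CLM_comp_left, Function.comp_apply,
    laplacian_monomial (Or.inl rfl) (Or.inl rfl), mul_assoc _ (zCoord y ^ _), ← mul_pow,
    conjForm_apply, zCoord_mul_conj]
  rw [Complex.reCLM_apply]
  refine Eq.trans (congrArg Complex.re ?_) (Complex.ofReal_re _)
  push_cast
  ring

theorem integral_sphereLaplacian {F : S3 → ℝ} (hF : IsSmooth3 F) :
    ∫ x, sphereLaplacian F x ∂vol3 = 0 := by
  have h1 : ∀ x, sphereLaplacian (fun _ => 1) x = 0 := fun x => by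
    rw [sphereLaplacian_restrict (u := fun _ => (1 : ℝ)) contDiff_const 0 (by simp)]
    simp [InnerProductSpace.laplacian_const]
  have h := integral_mul_sphereLaplacian hF (contMDiff_const (c := (1 : ℝ)))
  simpa [h1] using h.symm

/-- For `t = |Z|²` on the sphere, the Laplacian of `tⁿ⁺¹` is `4(n+1)²tⁿ - 4(n+1)(n+2)tⁿ⁺¹`. Its
integral is zero, so consecutive moments have ratio `(n+1)/(n+2)`. -/
theorem integral_zSq_pow (n : ℕ) : ∫ x : S3, zSq x ^ n ∂vol3 = 2 * Real.pi ^ 2 / (n + 1) := by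
  induction n with
  | zero => simp [volume_sphere]
  | succ n ih =>
    have cd : ContDiff ℝ ∞ fun y => zSq y ^ (n + 1) := contDiff_zSq.pow _
    have h := integral_sphereLaplacian (isSmooth3_restrict cd)
    have h2 : ∀ x : S3, sphereLaplacian (fun x : S3 => zSq x ^ (n + 1)) x =
        4 * (n + 1) ^ 2 * zSq x ^ n - 4 * (n + 1) * (n + 2) * zSq x ^ (n + 1) := fun x => by
      rw [sphereLaplacian_restrict cd (2 * (n + 1)), laplacian_zSq_pow]
      · push_cast
        ring
      · intro r y _
        simp only [zSq, PiLp.smul_apply, smul_eq_mul]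
        rw [pow_mul, ← mul_pow]
        ring
    have hi : ∀ n : ℕ, Integrable (fun x : S3 => zSq x ^ n) vol3 := fun n =>
      integrable_vol3 (continuous_zSq.pow n)
    rw [integral_congr_ae (.of_forall h2), integral_sub ((hi _).const_mul _) ((hi _).const_mul _),
      integral_const_mul, integral_const_mul, ih] at h
    have hn : (n : ℝ) + 1 ≠ 0 := by positivity
    have hn' : (n : ℝ) + 2 ≠ 0 := by positivity
    push_cast
    rw [eq_div_iff (by positivity)]
    field_simp at h
    have h3 : (n + 1 : ℝ) * ((n + 2) * ∫ x : S3, zSq x ^ (n + 1) ∂vol3) =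
        (n + 1) * (2 * Real.pi ^ 2) := by linarith
    have := mul_left_cancel₀ hn h3
    linarith

/-- Replacing one factor `|W|²` by `1 - |Z|²` gives the recursion of the Beta integral. -/
theorem integral_zSq_pow_mul_wSq_pow (a b : ℕ) :
    ∫ x : S3, zSq x ^ a * wSq x ^ b ∂vol3 =
      2 * Real.pi ^ 2 * (a.factorial * b.factorial / (a + b + 1).factorial) := by
  induction b generalizing a with
  | zero =>
    simp only [pow_zero, mul_one, integral_zSq_pow, Nat.factorial_zero, add_zero,
      Nat.factorial_succ, Nat.cast_one, Nat.cast_mul]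
    have := Nat.cast_ne_zero (R := ℝ).2 (Nat.factorial_ne_zero a)
    push_cast
    field_simp
  | succ b ih =>
    have h : ∀ x : S3, zSq x ^ a * wSq x ^ (b + 1) =
        zSq x ^ a * wSq x ^ b - zSq x ^ (a + 1) * wSq x ^ b := fun x => by
      rw [pow_succ (wSq _), pow_succ (zSq _)]
      nth_rewrite 2 [wSq_eq]
      ring
    have hi : ∀ a : ℕ, Integrable (fun x : S3 => zSq x ^ a * wSq x ^ b) vol3 := fun n => by
      simp only [wSq_eq]
      exact integrable_vol3 ((continuous_zSq.pow n).mul ((continuous_const.sub continuous_zSq).pow b))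
    rw [integral_congr_ae (.of_forall h), integral_sub (hi _) (hi _), ih, ih]
    rw [show a + (b + 1) + 1 = (a + b + 1) + 1 by ring, show a + 1 + b + 1 = (a + b + 1) + 1 by ring,
      Nat.factorial_succ (a + b + 1), Nat.factorial_succ a, Nat.factorial_succ b]
    have := Nat.cast_ne_zero (R := ℝ).2 (Nat.factorial_ne_zero (a + b + 1))
    push_cast
    field_simp
    ring

/-! ### Jacobi polynomials on the unit interval -/

/-- The Jacobi polynomial `P_d^{(a, b)}` in the variable `t = (u + 1) / 2`. -/
def jacobiPoly (a b d : ℕ) : ℝ[X] :=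
  ∑ i ∈ Finset.range (d + 1), C (jacobiCoeff a b d i) * (X ^ i * (X - C 1) ^ (d - i))

theorem eval_jacobiPoly (a b d : ℕ) (t : ℝ) : (jacobiPoly a b d).eval t =
    ∑ i ∈ Finset.range (d + 1), jacobiCoeff a b d i * (t ^ i * (t - 1) ^ (d - i)) := by
  simp [jacobiPoly, eval_finsetSum]

theorem monic_jacobiTerm (i j : ℕ) : (X ^ i * (X - C 1) ^ j : ℝ[X]).Monic :=
  (monic_X_pow i).mul ((monic_X_sub_C 1).pow j)

theorem natDegree_jacobiTerm (i j : ℕ) : (X ^ i * (X - C 1) ^ j : ℝ[X]).natDegree = i + j := by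
  rw [(monic_X_pow i).natDegree_mul ((monic_X_sub_C 1).pow j), natDegree_X_pow,
    (monic_X_sub_C 1).natDegree_pow, natDegree_X_sub_C, mul_one]

theorem natDegree_jacobiPoly_le (a b d : ℕ) : (jacobiPoly a b d).natDegree ≤ d := by
  refine natDegree_sum_le_of_forall_le _ _ fun i hi => (natDegree_C_mul_le _ _).trans ?_
  have := Finset.mem_range.1 hi
  rw [natDegree_jacobiTerm]
  omega

/-- Every term is its coefficient times a monic polynomial of degree `d`; the coefficients add up by
Vandermonde's identity. -/
theorem coeff_jacobiPoly (a b d : ℕ) :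
    (jacobiPoly a b d).coeff d = (a + b + 2 * d).choose d := by
  have h : ∀ i ∈ Finset.range (d + 1),
      (C (jacobiCoeff a b d i) * (X ^ i * (X - C 1) ^ (d - i))).coeff d = jacobiCoeff a b d i := by
    intro i hi
    have hi' := Finset.mem_range.1 hi
    have hd : (X ^ i * (X - C 1) ^ (d - i) : ℝ[X]).natDegree = d := by
      rw [natDegree_jacobiTerm]
      omega
    have := (monic_jacobiTerm i (d - i)).coeff_natDegree
    rw [hd] at this
    rw [coeff_C_mul, this, mul_one]
  rw [jacobiPoly, finsetSum_coeff, Finset.sum_congr rfl h,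
    show a + b + 2 * d = (a + d) + (b + d) by ring, Nat.add_choose_eq,
    Finset.Nat.sum_antidiagonal_eq_sum_range_succ_mk]
  push_cast
  rfl

theorem choose_degree_ne_zero (a b d : ℕ) : ((a + b + 2 * d).choose d : ℝ) ≠ 0 :=
  Nat.cast_ne_zero.2 (Nat.choose_pos (by omega)).ne'

theorem degree_jacobiPoly (a b d : ℕ) : (jacobiPoly a b d).degree = d := by
  have h := coeff_jacobiPoly a b d
  refine degree_eq_of_le_of_coeff_ne_zero
    (degree_le_of_natDegree_le (natDegree_jacobiPoly_le a b d)) ?_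
  rw [h]
  exact choose_degree_ne_zero a b d

/-- The Jacobi polynomials with fixed parameters, one in each degree. -/
def jacobiSequence (a b : ℕ) : Polynomial.Sequence ℝ where
  elems' := jacobiPoly a b
  degree_eq' := degree_jacobiPoly a b

theorem map_eq_zero_of_jacobiPoly {A : Type*} [AddCommGroup A] [Module ℝ A] (Λ : ℝ[X] →ₗ[ℝ] A)
    (a b N : ℕ) (h : ∀ j < N, Λ (jacobiPoly a b j) = 0) {Q : ℝ[X]} (hQ : Q.degree < N) :
    Λ Q = 0 := by
  have hs := (jacobiSequence a b).span_degreeLT (m := N) fun i _ =>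
    (isUnit_iff_ne_zero.2 (leadingCoeff_ne_zero.2 ((jacobiSequence a b).ne_zero i)))
  have hQ' : Q ∈ Submodule.span ℝ (jacobiSequence a b '' Set.Iio N) := by
    rw [hs]
    exact mem_degreeLT.2 hQ
  have hle : Submodule.span ℝ (jacobiSequence a b '' Set.Iio N) ≤ LinearMap.ker Λ := by
    rw [Submodule.span_le]
    rintro _ ⟨j, hj, rfl⟩
    exact h j hj
  exact hle hQ'

/-- Up to the sign `(-1)^d`, this compares the coefficients of `x^d` in `(1+x)^(-(L+1)) (1+x)^L =
(1+x)^(-1)`, that is, Chu–Vandermonde with a negative upper index. -/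
theorem alternating_choose_sum (L d : ℕ) :
    ∑ i ∈ Finset.range (d + 1), (-1 : ℤ) ^ (d - i) * L.choose (d - i) * (L + i).choose i = 1 := by
  have h := Ring.add_choose_eq (r := -((L : ℤ) + 1)) (s := (L : ℤ)) d (Commute.all _ _)
  rw [Finset.Nat.sum_antidiagonal_eq_sum_range_succ_mk,
    show -((L : ℤ) + 1) + L = -1 by ring] at h
  have h1 : ∀ (n i : ℕ), Ring.choose (-((n : ℤ) + 1)) i = (-1) ^ i * ((n + i).choose i : ℤ) := by
    intro n i
    rw [Ring.choose_neg, show (n : ℤ) + 1 + i - 1 = ((n + i : ℕ) : ℤ) by push_cast; ring,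
      Ring.choose_natCast]
    simp [Int.negOnePow_def, Units.smul_def]
  have h2 := h1 0 d
  simp only [Nat.cast_zero, zero_add, Nat.choose_self, Nat.cast_one, mul_one] at h2
  rw [h2] at h
  have h3 : ∑ i ∈ Finset.range (d + 1), (-1 : ℤ) ^ (d - i) * L.choose (d - i) * (L + i).choose i =
      (-1) ^ d * ∑ i ∈ Finset.range (d + 1),
        Ring.choose (-((L : ℤ) + 1)) i * Ring.choose (L : ℤ) (d - i) := by
    rw [Finset.mul_sum]
    refine Finset.sum_congr rfl fun i hi => ?_
    have hi' : i ≤ d := Nat.lt_succ_iff.1 (Finset.mem_range.1 hi)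
    rw [h1, Ring.choose_natCast]
    have : (-1 : ℤ) ^ d * (-1) ^ i = (-1) ^ (d - i) := by
      obtain ⟨j, rfl⟩ := Nat.exists_eq_add_of_le hi'
      rw [Nat.add_sub_cancel_left, pow_add, mul_right_comm, ← mul_pow]
      simp
    linear_combination -((L + i).choose i : ℤ) * (L.choose (d - i) : ℤ) * this
  rw [h3, ← h, ← mul_pow]
  simp

/-! ### The norm of the harmonic polynomials -/

/-- On the sphere `-|W|² = |Z|² - 1`, which turns the homogeneous form into the Jacobi polynomial in
`|Z|²`. -/
theorem harm_coe (d : ℕ) (l m : ℤ) (x : S3) : harm d l m x =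
    signPow (zCoord x) l * signPow (wCoord x) m *
      (((jacobiPoly m.natAbs l.natAbs d).eval (zSq x) : ℝ) : ℂ) := by
  unfold harm
  rw [eval_jacobiPoly, zCoord_mul_conj, wCoord_mul_conj, wSq_eq]
  push_cast
  congr 1
  refine Finset.sum_congr rfl fun i _ => ?_
  ring

theorem signPow_mul_neg (z : ℂ) (n : ℤ) : signPow z n * signPow z (-n) = (z * conj z) ^ n.natAbs := by
  rw [signPow_neg, signPow]
  split_ifs
  · rw [map_pow, mul_pow]
  · rw [map_pow, Complex.conj_conj, mul_pow, mul_comm]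

/-- Integration of `G` against a polynomial in `zSq`. -/
def polyIntegral {G : S3 → ℂ} (hG : Continuous G) : ℝ[X] →ₗ[ℝ] ℂ where
  toFun Q := ∫ x, G x * ((Q.eval (zSq x) : ℝ) : ℂ) ∂vol3
  map_add' P Q := by
    have hi : ∀ Q : ℝ[X], Integrable (fun x => G x * ((Q.eval (zSq x) : ℝ) : ℂ)) vol3 := fun Q =>
      integrable_vol3 (hG.mul (Complex.continuous_ofReal.comp (Q.continuous.comp continuous_zSq)))
    rw [← integral_add (hi P) (hi Q)]
    refine integral_congr_ae (.of_forall fun x => ?_)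
    simp [mul_add]
  map_smul' r Q := by
    rw [RingHom.id_apply, Complex.real_smul, ← integral_const_mul]
    refine integral_congr_ae (.of_forall fun x => ?_)
    simp
    ring

theorem polyIntegral_apply {G : S3 → ℂ} (hG : Continuous G) (Q : ℝ[X]) :
    polyIntegral hG Q = ∫ x, G x * ((Q.eval (zSq x) : ℝ) : ℂ) ∂vol3 := rfl

theorem harm_mul_harm_neg (d d' : ℕ) (l m : ℤ) (x : S3) :
    harm d l m x * harm d' (-l) (-m) x =
      ((zSq x ^ l.natAbs * wSq x ^ m.natAbs * (jacobiPoly m.natAbs l.natAbs d).eval (zSq x) : ℝ) : ℂ)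
        * (((jacobiPoly m.natAbs l.natAbs d').eval (zSq x) : ℝ) : ℂ) := by
  have h1 := signPow_mul_neg (zCoord x) l
  have h2 := signPow_mul_neg (wCoord x) m
  rw [zCoord_mul_conj] at h1
  rw [wCoord_mul_conj] at h2
  rw [harm_coe, harm_coe, Int.natAbs_neg, Int.natAbs_neg]
  push_cast
  rw [← h1, ← h2]
  ring

theorem continuous_jacobi_weight (a b d : ℕ) : Continuous fun x : S3 =>
    ((zSq x ^ b * wSq x ^ a * (jacobiPoly a b d).eval (zSq x) : ℝ) : ℂ) := by
  simp only [wSq_eq]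
  exact Complex.continuous_ofReal.comp (((continuous_zSq.pow b).mul
    ((continuous_const.sub continuous_zSq).pow a)).mul
      ((jacobiPoly a b d).continuous.comp continuous_zSq))

/-- Jacobi polynomials of degrees `j < d` are orthogonal because they come from harmonic polynomials
of opposite weights and different degrees; those with `j < d` span all polynomials of degree below
`d`. -/
theorem polyIntegral_jacobi_eq_zero (a b d : ℕ) {Q : ℝ[X]} (hQ : Q.degree < d) :
    polyIntegral (continuous_jacobi_weight a b d) Q = 0 := by
  refine map_eq_zero_of_jacobiPoly _ a b d (fun j hj => ?_) hQ
  have h := integral_harm_mul_harm_of_degree_ne (d := d) (d' := j) (l := b) (m := a)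
    (l' := -(b : ℤ)) (m' := -(a : ℤ)) (by simp; omega)
  rw [integral_congr_ae (.of_forall fun x : S3 => harm_mul_harm_neg d j b a x)] at h
  exact h

/-- Absorbing the factorials into the binomial coefficients leaves `alternating_choose_sum` with `L
= b + d`. -/
theorem jacobi_factorial_sum (a b d : ℕ) :
    ∑ i ∈ Finset.range (d + 1), jacobiCoeff a b d i * (-1) ^ (d - i) *
      ((b + d + i).factorial * (a + (d - i)).factorial) =
        ((a + d).factorial : ℝ) * (b + d).factorial := by
  have h := congrArg (Int.cast (R := ℝ)) (alternating_choose_sum (b + d) d)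
  push_cast at h
  refine Eq.trans ?_ ((congrArg (fun r => ((a + d).factorial : ℝ) * (b + d).factorial * r) h).trans
    (mul_one _))
  rw [Finset.mul_sum]
  refine Finset.sum_congr rfl fun i hi => ?_
  have hi' : i ≤ d := Nat.lt_succ_iff.1 (Finset.mem_range.1 hi)
  have h1 : ((a + d).choose i : ℝ) * i.factorial * (a + (d - i)).factorial = (a + d).factorial := by
    have := Nat.choose_mul_factorial_mul_factorial (show i ≤ a + d by omega)
    rw [show a + d - i = a + (d - i) by omega] at this
    exact_mod_cast this
  have h2 : ((b + d + i).choose i : ℝ) * i.factorial * (b + d).factorial = (b + d + i).factorial := by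
    have := Nat.choose_mul_factorial_mul_factorial (show i ≤ b + d + i by omega)
    rw [show b + d + i - i = b + d by omega] at this
    exact_mod_cast this
  unfold jacobiCoeff
  rw [← h1, ← h2]
  ring

/-- The exponents of the moments have the same sum in every term, so all terms share one
denominator. -/
theorem polyIntegral_jacobi_X_pow (a b d : ℕ) :
    polyIntegral (continuous_jacobi_weight a b d) (X ^ d) =
      ((2 * Real.pi ^ 2 * ((a + d).factorial * (b + d).factorial /
        (a + b + 2 * d + 1).factorial) : ℝ) : ℂ) := by
  rw [polyIntegral_apply]
  have h : ∀ x : S3, ((zSq x ^ b * wSq x ^ a * (jacobiPoly a b d).eval (zSq x) : ℝ) : ℂ) *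
      (((X ^ d : ℝ[X]).eval (zSq x) : ℝ) : ℂ) = ((∑ i ∈ Finset.range (d + 1),
        (jacobiCoeff a b d i * (-1) ^ (d - i)) *
          (zSq x ^ (b + d + i) * wSq x ^ (a + (d - i))) : ℝ) : ℂ) := fun x => by
    rw [← Complex.ofReal_mul, eval_jacobiPoly, eval_pow, eval_X, Finset.mul_sum, Finset.sum_mul]
    congr 1
    refine Finset.sum_congr rfl fun i _ => ?_
    rw [show zSq x - 1 = -wSq x by rw [wSq_eq]; ring, neg_pow]
    ring
  have hi : ∀ a b : ℕ, Integrable (fun x : S3 => zSq x ^ a * wSq x ^ b) vol3 := fun a b => by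
    simp only [wSq_eq]
    exact integrable_vol3 ((continuous_zSq.pow a).mul ((continuous_const.sub continuous_zSq).pow b))
  rw [integral_congr_ae (.of_forall h), integral_complex_ofReal,
    integral_finsetSum _ fun i _ => (hi _ _).const_mul _]
  congr 1
  rw [← jacobi_factorial_sum, Finset.sum_div, Finset.mul_sum]
  refine Finset.sum_congr rfl fun i hi => ?_
  have hi' : i ≤ d := Nat.lt_succ_iff.1 (Finset.mem_range.1 hi)
  rw [integral_const_mul, integral_zSq_pow_mul_wSq_pow,
    show b + d + i + (a + (d - i)) + 1 = a + b + 2 * d + 1 by omega]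
  ring

/-- The integral over the sphere of the squared modulus of `harm d l m`, where `a = |m|` and
`b = |l|`. -/
def harmNormSq (a b d : ℕ) : ℝ :=
  2 * Real.pi ^ 2 * (((b + d).factorial * (a + d).factorial : ℝ) /
    ((a + b + 2 * d + 1) * d.factorial * (b + a + d).factorial))

theorem integral_harm_mul_harm_neg (d : ℕ) (l m : ℤ) :
    ∫ x : S3, harm d l m x * harm d (-l) (-m) x ∂vol3 = harmNormSq m.natAbs l.natAbs d := by
  set a := m.natAbs
  set b := l.natAbs
  have h1 : ∫ x : S3, harm d l m x * harm d (-l) (-m) x ∂vol3 =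
      polyIntegral (continuous_jacobi_weight a b d) (jacobiPoly a b d) :=
    integral_congr_ae (.of_forall fun x : S3 => harm_mul_harm_neg d d l m x)
  set c : ℝ := Nat.cast ((a + b + 2 * d).choose d) with hc
  -- Modulo lower degrees, which integrate to zero, the second factor may be replaced by its leading
  -- term.
  have h3 : (jacobiPoly a b d - c • X ^ d).degree < (d : WithBot ℕ) := by
    rw [degree_lt_iff_coeff_zero]
    intro n hn
    rcases hn.eq_or_lt with rfl | hn
    · simp [coeff_jacobiPoly, hc]
    · rw [coeff_sub, coeff_eq_zero_of_natDegree_lt ((natDegree_jacobiPoly_le a b d).trans_lt hn)]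
      simp [coeff_X_pow, hn.ne']
  have h2 := polyIntegral_jacobi_eq_zero a b d h3
  rw [map_sub, sub_eq_zero] at h2
  rw [h1, h2, map_smul, polyIntegral_jacobi_X_pow, Complex.real_smul, ← Complex.ofReal_mul]
  congr 1
  have h4 : c * d.factorial * (b + a + d).factorial = (a + b + 2 * d).factorial := by
    have := Nat.choose_mul_factorial_mul_factorial (show d ≤ a + b + 2 * d by omega)
    rw [show a + b + 2 * d - d = b + a + d by omega] at this
    rw [hc]
    exact_mod_cast this
  rw [harmNormSq, Nat.factorial_succ (a + b + 2 * d)]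
  push_cast
  rw [← h4]
  have h5 := Nat.cast_ne_zero (R := ℝ).2 (Nat.factorial_ne_zero d)
  have h6 := Nat.cast_ne_zero (R := ℝ).2 (Nat.factorial_ne_zero (b + a + d))
  have h7 : c ≠ 0 := choose_degree_ne_zero a b d
  field_simp

/-! ### Completeness of the harmonic polynomials -/

theorem continuous_signPow (L : E4 →L[ℝ] ℂ) (n : ℤ) :
    Continuous fun x : S3 => signPow (L x) n := by
  simp only [signPow_eq]
  exact ((signForm L n).continuous.comp continuous_subtype_val).pow _

theorem signPow_mul_pow_min (z : ℂ) (a b : ℕ) :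
    z ^ a * conj z ^ b = signPow z ((a : ℤ) - b) * (z * conj z) ^ min a b := by
  unfold signPow
  rcases le_total b a with h | h
  · rw [if_pos (by omega), min_eq_right h]
    obtain ⟨c, rfl⟩ := Nat.exists_eq_add_of_le h
    rw [show ((b + c : ℕ) : ℤ) - b = c by push_cast; ring, Int.natAbs_natCast]
    ring
  · rw [min_eq_left h]
    obtain ⟨c, rfl⟩ := Nat.exists_eq_add_of_le h
    rw [show (a : ℤ) - (a + c : ℕ) = -c by push_cast; ring, Int.natAbs_neg, Int.natAbs_natCast]
    rcases Nat.eq_zero_or_pos c with rfl | hc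
    · simp [mul_pow]
    · rw [if_neg (by omega)]
      ring

/-- On the sphere a monomial is a pair of signed powers times a polynomial in `|Z|²`, and the latter
is a combination of the Jacobi polynomials belonging to that weight. -/
theorem integral_mul_monomial_eq_zero {F : S3 → ℂ} (hF : Continuous F)
    (h : ∀ d l m, ∫ x : S3, F x * harm d l m x ∂vol3 = 0) (a b c e : ℕ) :
    ∫ x : S3, F x * (zCoord x ^ a * conj (zCoord x) ^ b *
      (wCoord x ^ c * conj (wCoord x) ^ e)) ∂vol3 = 0 := by
  set l : ℤ := (a : ℤ) - b
  set m : ℤ := (c : ℤ) - e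
  have hG : Continuous fun x : S3 => F x * (signPow (zCoord x) l * signPow (wCoord x) m) :=
    hF.mul ((continuous_signPow zCoord l).mul (continuous_signPow wCoord m))
  set Q : ℝ[X] := X ^ min a b * (1 - X) ^ min c e
  have hQ : polyIntegral hG Q = 0 := by
    refine map_eq_zero_of_jacobiPoly _ m.natAbs l.natAbs (Q.natDegree + 1) (fun j _ => ?_)
      (degree_le_natDegree.trans_lt (by exact_mod_cast Nat.lt_succ_self _))
    rw [← h j l m, polyIntegral_apply]
    refine integral_congr_ae (.of_forall fun x => ?_)
    simp only [harm_coe]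
    ring
  rw [← hQ, polyIntegral_apply]
  refine integral_congr_ae (.of_forall fun x => ?_)
  simp only
  rw [signPow_mul_pow_min, signPow_mul_pow_min, zCoord_mul_conj, wCoord_mul_conj, wSq_eq]
  simp only [Q, eval_mul, eval_pow, eval_X, eval_sub, eval_one]
  push_cast
  ring

/-- The restriction of a linear form to the sphere. -/
def formMap (L : E4 →L[ℝ] ℂ) : C(S3, ℂ) := ⟨fun x => L x, L.continuous.comp continuous_subtype_val⟩

/-- A continuous function on the sphere is annihilated by all monomials. -/
def KillsMonomials (F : C(S3, ℂ)) : Prop := ∀ a b c e : ℕ,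
  ∫ x : S3, F x * (zCoord x ^ a * conj (zCoord x) ^ b *
    (wCoord x ^ c * conj (wCoord x) ^ e)) ∂vol3 = 0

/-- The quantification over `F` is what the product case of the induction needs: there the second
factor is applied to `F * g₁`. -/
theorem KillsMonomials.mul_mem_adjoin {g : C(S3, ℂ)}
    (hg : g ∈ StarAlgebra.adjoin ℂ {formMap zCoord, formMap wCoord}) :
    ∀ F : C(S3, ℂ), KillsMonomials F → KillsMonomials (F * g) := by
  have hg' : g ∈ Algebra.adjoin ℂ ({formMap zCoord, formMap wCoord} ∪
    star {formMap zCoord, formMap wCoord}) := hg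
  clear hg
  induction hg' using Algebra.adjoin_induction with
  | mem g hg =>
    intro F hF a b c e
    have : g = formMap zCoord ∨ g = formMap wCoord ∨ g = star (formMap zCoord) ∨
        g = star (formMap wCoord) := by
      simp only [Set.mem_union, Set.mem_insert_iff, Set.mem_singleton_iff, Set.mem_star] at hg
      rcases hg with (h | h) | h | h
      · exact Or.inl h
      · exact Or.inr (Or.inl h)
      · exact Or.inr (Or.inr (Or.inl (by rw [← h, star_star])))
      · exact Or.inr (Or.inr (Or.inr (by rw [← h, star_star])))
    rcases this with rfl | rfl | rfl | rfl
    · rw [← hF (a + 1) b c e]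
      refine integral_congr_ae (.of_forall fun x => ?_)
      simp [formMap]
      ring
    · rw [← hF a b (c + 1) e]
      refine integral_congr_ae (.of_forall fun x => ?_)
      simp [formMap]
      ring
    · rw [← hF a (b + 1) c e]
      refine integral_congr_ae (.of_forall fun x => ?_)
      simp [formMap]
      ring
    · rw [← hF a b c (e + 1)]
      refine integral_congr_ae (.of_forall fun x => ?_)
      simp [formMap]
      ring
  | algebraMap r =>
    intro F hF a b c e
    have := congrArg (fun w => r * w) (hF a b c e)
    simp only [mul_zero] at this
    rw [← this, ← integral_const_mul]
    refine integral_congr_ae (.of_forall fun x => ?_)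
    simp
    ring
  | add g₁ g₂ _ _ ih₁ ih₂ =>
    intro F hF a b c e
    have hm : Continuous fun x : S3 => zCoord x ^ a * conj (zCoord x) ^ b *
        (wCoord x ^ c * conj (wCoord x) ^ e) := by fun_prop
    have hi : ∀ g : C(S3, ℂ), Integrable (fun x : S3 => g x * (zCoord x ^ a * conj (zCoord x) ^ b *
        (wCoord x ^ c * conj (wCoord x) ^ e))) vol3 := fun g => integrable_vol3 (g.continuous.mul hm)
    have := congrArg₂ (· + ·) (ih₁ F hF a b c e) (ih₂ F hF a b c e)
    simp only [add_zero] at this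
    rw [← this, ← integral_add (hi _) (hi _)]
    refine integral_congr_ae (.of_forall fun x => ?_)
    simp
    ring
  | mul g₁ g₂ _ _ ih₁ ih₂ =>
    intro F hF
    rw [← mul_assoc]
    exact ih₂ _ (ih₁ F hF)

theorem separatesPoints_adjoin :
    (StarAlgebra.adjoin ℂ {formMap zCoord, formMap wCoord}).SeparatesPoints := by
  intro x y hxy
  by_contra hcon
  push Not at hcon
  have hz : zCoord x = zCoord y := hcon _ ⟨formMap zCoord,
    StarAlgebra.subset_adjoin _ _ (by simp), rfl⟩
  have hw : wCoord x = wCoord y := hcon _ ⟨formMap wCoord,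
    StarAlgebra.subset_adjoin _ _ (by simp), rfl⟩
  rw [zCoord_apply, zCoord_apply, Complex.ext_iff] at hz
  rw [wCoord_apply, wCoord_apply, Complex.ext_iff] at hw
  apply hxy
  ext i
  fin_cases i
  · simpa using hz.1
  · simpa using hz.2
  · simpa using hw.1
  · simpa using hw.2

/-- Integration against `f` is a continuous functional that vanishes on the star algebra generated
by `Z` and `W`, which is dense by Stone–Weierstrass. It therefore vanishes at `f` itself, and `f` is
real. -/
theorem eq_zero_of_integral_mul_harm_eq_zero {f : S3 → ℝ} (hf : Continuous f)
    (h : ∀ d l m, ∫ x : S3, (f x : ℂ) * harm d l m x ∂vol3 = 0) : f = 0 := by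
  let F : C(S3, ℂ) := ⟨fun x => (f x : ℂ), Complex.continuous_ofReal.comp hf⟩
  have hF : KillsMonomials F := integral_mul_monomial_eq_zero F.continuous h
  let I : C(S3, ℂ) →L[ℂ] ℂ := LinearMap.mkContinuous
    { toFun := fun g => ∫ x, F x * g x ∂vol3
      map_add' := fun g₁ g₂ => by
        have hi : ∀ g : C(S3, ℂ), Integrable (fun x => F x * g x) vol3 := fun g =>
          integrable_vol3 (F.continuous.mul g.continuous)
        rw [← integral_add (hi g₁) (hi g₂)]
        simp [mul_add]
      map_smul' := fun r g => by
        rw [RingHom.id_apply, smul_eq_mul, ← integral_const_mul]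
        refine integral_congr_ae (.of_forall fun x => ?_)
        simp
        ring }
    (‖F‖ * vol3.real Set.univ) fun g => by
      have : ∀ x, ‖F x * g x‖ ≤ ‖F‖ * ‖g‖ := fun x => by
        rw [norm_mul]
        exact mul_le_mul (F.norm_coe_le_norm x) (g.norm_coe_le_norm x) (norm_nonneg _)
          (norm_nonneg _)
      refine (norm_integral_le_of_norm_le_const (.of_forall this)).trans (le_of_eq ?_)
      ring
  have hI : ∀ g ∈ (StarAlgebra.adjoin ℂ {formMap zCoord, formMap wCoord}), I g = 0 := by
    intro g hg
    have := KillsMonomials.mul_mem_adjoin hg F hF 0 0 0 0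
    simp only [pow_zero, mul_one, ContinuousMap.mul_apply] at this
    exact this
  have hcl : ∀ g, I g = 0 := by
    intro g
    have hg : g ∈ (StarAlgebra.adjoin ℂ {formMap zCoord, formMap wCoord}).topologicalClosure := by
      rw [ContinuousMap.starSubalgebra_topologicalClosure_eq_top_of_separatesPoints _
        separatesPoints_adjoin]
      trivial
    have hsub : closure ((StarAlgebra.adjoin ℂ {formMap zCoord, formMap wCoord} : Set C(S3, ℂ))) ⊆
        {g | I g = 0} :=
      closure_minimal hI (isClosed_eq I.continuous continuous_const)
    exact hsub hg
  have h0 : ∫ x, f x * f x ∂vol3 = 0 := by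
    have h1 : ∫ x, (f x : ℂ) * (f x : ℂ) ∂vol3 = 0 := hcl F
    have h2 : ∫ x, ((f x * f x : ℝ) : ℂ) ∂vol3 = 0 := by
      rw [← h1]
      simp
    rw [integral_complex_ofReal] at h2
    exact_mod_cast h2
  have hc : Continuous fun x => f x * f x := hf.mul hf
  rw [integral_eq_zero_iff_of_nonneg (fun x => mul_self_nonneg _) (integrable_vol3 hc)] at h0
  have := (hc.ae_eq_iff_eq vol3 continuous_zero).1 h0
  funext x
  exact mul_self_eq_zero.1 (congrFun this x)

/-! ### Real and imaginary parts -/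

/-- The imaginary part if `s` holds, the real part otherwise. -/
def part (s : Bool) : ℂ →L[ℝ] ℝ := if s then Complex.imCLM else Complex.reCLM

theorem part_true (z : ℂ) : part true z = z.im := rfl

theorem part_false (z : ℂ) : part false z = z.re := rfl

/-- A product of real or imaginary parts is half a part of `F · conj G` plus or minus half a part of
`F · G`, and these two integrals are known from the weights. -/
theorem integral_part_mul_part {F G : S3 → ℂ} (hF : Continuous F) (hG : Continuous G)
    (s t : Bool) : ∫ x, part s (F x) * part t (G x) ∂vol3 =
      1 / 2 * (if s = t then (∫ x, F x * conj (G x) ∂vol3).re else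
          (if s then 1 else -1) * (∫ x, F x * conj (G x) ∂vol3).im) +
        1 / 2 * (if s = t then (if s then -1 else 1) * (∫ x, F x * G x ∂vol3).re else
          (∫ x, F x * G x ∂vol3).im) := by
  have h1 : Integrable (fun x => F x * G x) vol3 := integrable_vol3 (hF.mul hG)
  have h2 : Integrable (fun x => F x * conj (G x)) vol3 :=
    integrable_vol3 (hF.mul (Complex.continuous_conj.comp hG))
  have r1 := Complex.reCLM.integral_comp_comm h1
  have i1 := Complex.imCLM.integral_comp_comm h1
  have r2 := Complex.reCLM.integral_comp_comm h2
  have i2 := Complex.imCLM.integral_comp_comm h2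
  have r1' := Complex.reCLM.integrable_comp h1
  have i1' := Complex.imCLM.integrable_comp h1
  have r2' := Complex.reCLM.integrable_comp h2
  have i2' := Complex.imCLM.integrable_comp h2
  simp only [Complex.reCLM_apply, Complex.imCLM_apply] at r1 i1 r2 i2 r1' i1' r2' i2'
  rw [← r1, ← i1, ← r2, ← i2]
  cases s <;> cases t <;>
    simp only [if_true, if_false, Bool.false_eq_true, reduceCtorEq, ← integral_const_mul] <;>
    rw [← integral_add (by fun_prop) (by fun_prop)] <;>
    refine integral_congr_ae (.of_forall fun x => ?_) <;>
    simp [part_true, part_false] <;> ring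

/-- A pair of integers lies in the half plane `l > 0` or on the half line `l = 0`, `m ≥ 0`. -/
def IsHalf (l m : ℤ) : Prop := 0 < l ∨ (l = 0 ∧ 0 ≤ m)

/-- In the half plane, two weights add up to zero only if both are zero; hence for distinct weights
both integrals, with and without conjugate, vanish. -/
theorem integral_part_harm_eq_zero {d d' : ℕ} {l m l' m' : ℤ} (h : IsHalf l m) (h' : IsHalf l' m')
    (hne : l ≠ l' ∨ m ≠ m') (s t : Bool) :
    ∫ x : S3, part s (harm d l m x) * part t (harm d' l' m' x) ∂vol3 = 0 := by
  rw [integral_part_mul_part (continuous_harm d l m) (continuous_harm d' l' m')]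
  have h1 : ∫ x : S3, harm d l m x * conj (harm d' l' m' x) ∂vol3 = 0 := by
    simp only [← harm_neg]
    exact integral_harm_mul_harm_of_weight_ne d d' (by omega)
  have h2 : ∫ x : S3, harm d l m x * harm d' l' m' x ∂vol3 = 0 := by
    refine integral_harm_mul_harm_of_weight_ne d d' ?_
    unfold IsHalf at h h'
    omega
  rw [h1, h2]
  simp

/-- The square has the nonzero weight `(2l, 2m)` and integrates to zero, so each part carries half
of the norm. For weight zero the function is real and keeps the whole norm, which explains the two
cases in `normFactor`. -/
theorem integral_part_harm {l m : ℤ} (h : l ≠ 0 ∨ m ≠ 0) (d : ℕ) (s t : Bool) :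
    ∫ x : S3, part s (harm d l m x) * part t (harm d l m x) ∂vol3 =
      if s = t then harmNormSq m.natAbs l.natAbs d / 2 else 0 := by
  rw [integral_part_mul_part (continuous_harm d l m) (continuous_harm d l m)]
  have h1 : ∫ x : S3, harm d l m x * conj (harm d l m x) ∂vol3 =
      harmNormSq m.natAbs l.natAbs d := by
    simp only [← harm_neg]
    exact integral_harm_mul_harm_neg d l m
  have h2 : ∫ x : S3, harm d l m x * harm d l m x ∂vol3 = 0 :=
    integral_harm_mul_harm_of_weight_ne d d (by omega)
  rw [h1, h2]
  split_ifs <;> simp [div_eq_inv_mul]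

theorem conj_harm_zero (d : ℕ) (y : E4) : conj (harm d 0 0 y) = harm d 0 0 y := by
  rw [← harm_neg, neg_zero]

theorem part_true_harm_zero (d : ℕ) (y : E4) : part true (harm d 0 0 y) = 0 :=
  Complex.conj_eq_iff_im.1 (conj_harm_zero d y)

theorem integral_part_harm_zero (d : ℕ) :
    ∫ x : S3, part false (harm d 0 0 x) * part false (harm d 0 0 x) ∂vol3 = harmNormSq 0 0 d := by
  rw [integral_part_mul_part (continuous_harm d 0 0) (continuous_harm d 0 0)]
  have h1 : ∫ x : S3, harm d 0 0 x * harm d 0 0 x ∂vol3 = harmNormSq 0 0 d := by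
    simpa using integral_harm_mul_harm_neg d 0 0
  simp only [conj_harm_zero, h1]
  simp
  ring

theorem harmNormSq_pos (a b d : ℕ) : 0 < harmNormSq a b d := by
  unfold harmNormSq
  have := Real.pi_pos
  positivity

/-- The factor that normalizes the real and imaginary parts of `harm d l m`. -/
def normFactor (d : ℕ) (l m : ℤ) : ℝ :=
  √((if l = 0 ∧ m = 0 then 1 else 2) / harmNormSq m.natAbs l.natAbs d)

theorem normFactor_pos (d : ℕ) (l m : ℤ) : 0 < normFactor d l m := by
  have := harmNormSq_pos m.natAbs l.natAbs d
  unfold normFactor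
  split_ifs <;> positivity

/-- The normalized real or imaginary part of `harm d l m`. -/
def realHarm (s : Bool) (d : ℕ) (l m : ℤ) (x : S3) : ℝ := normFactor d l m * part s (harm d l m x)

theorem integral_realHarm_mul (s s' : Bool) (d d' : ℕ) (l m l' m' : ℤ) :
    ∫ x, realHarm s d l m x * realHarm s' d' l' m' x ∂vol3 = normFactor d l m * normFactor d' l' m' *
      ∫ x : S3, part s (harm d l m x) * part s' (harm d' l' m' x) ∂vol3 := by
  rw [← integral_const_mul]
  refine integral_congr_ae (.of_forall fun x => ?_)
  simp only [realHarm]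
  ring

theorem integral_realHarm_sq {s : Bool} (d : ℕ) {l m : ℤ} (h : s = true → l ≠ 0 ∨ m ≠ 0) :
    ∫ x, realHarm s d l m x * realHarm s d l m x ∂vol3 = 1 := by
  have hN := harmNormSq_pos m.natAbs l.natAbs d
  rw [integral_realHarm_mul, normFactor, Real.mul_self_sqrt (by split_ifs <;> positivity)]
  by_cases h0 : l = 0 ∧ m = 0
  · obtain ⟨rfl, rfl⟩ := h0
    have hs : s = false := by
      cases s
      · rfl
      · simp at h
    subst hs
    rw [integral_part_harm_zero]
    simpa using div_mul_cancel₀ 1 hN.ne'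
  · rw [integral_part_harm (by tauto), if_neg h0, if_pos rfl]
    field_simp

theorem integral_realHarm_eq_zero {s s' : Bool} {d d' : ℕ} {l m l' m' : ℤ} (h : IsHalf l m)
    (h' : IsHalf l' m') (hd : l.natAbs + m.natAbs + 2 * d = l'.natAbs + m'.natAbs + 2 * d')
    (hs : s = true → l ≠ 0 ∨ m ≠ 0) (hs' : s' = true → l' ≠ 0 ∨ m' ≠ 0)
    (hne : ¬ (s = s' ∧ l = l' ∧ m = m')) :
    ∫ x, realHarm s d l m x * realHarm s' d' l' m' x ∂vol3 = 0 := by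
  rw [integral_realHarm_mul]
  by_cases hlm : l = l' ∧ m = m'
  · obtain ⟨rfl, rfl⟩ := hlm
    obtain rfl : d = d' := by omega
    have hss : s ≠ s' := by tauto
    rw [integral_part_harm, if_neg hss, mul_zero]
    cases s <;> cases s' <;> simp_all
  · rw [integral_part_harm_eq_zero h h' (by tauto), mul_zero]

theorem isSmooth3_realHarm (s : Bool) (d : ℕ) (l m : ℤ) : IsSmooth3 (realHarm s d l m) :=
  isSmooth3_clm_harm (normFactor d l m • part s) d l m

theorem sphereLaplacian_realHarm (s : Bool) (d : ℕ) (l m : ℤ) {k : ℕ}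
    (hk : k = l.natAbs + m.natAbs + 2 * d) (x : S3) :
    sphereLaplacian (realHarm s d l m) x = -((k : ℝ) * (k + 2)) * realHarm s d l m x :=
  sphereLaplacian_clm_harm (normFactor d l m • part s) d l m hk x

/-! ### Harmonic polynomials in toroidal coordinates -/

theorem jacobi_eq_eval (a b d : ℕ) (t : ℝ) :
    jacobi a b d (2 * t - 1) = (jacobiPoly a b d).eval t := by
  rw [jacobi, eval_jacobiPoly, Finset.mul_sum]
  refine Finset.sum_congr rfl fun i hi => ?_
  have hi' : i ≤ d := Nat.lt_succ_iff.1 (Finset.mem_range.1 hi)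
  rw [show 2 * t - 1 + 1 = 2 * t by ring, show 2 * t - 1 - 1 = 2 * (t - 1) by ring, mul_pow, mul_pow,
    jacobiCoeff, ← pow_mul_pow_sub (2 : ℝ) hi']
  field_simp

theorem signPow_ofReal (r : ℝ) (n : ℤ) : signPow (r : ℂ) n = (r ^ n.natAbs : ℝ) := by
  unfold signPow
  split_ifs <;> simp

/-- The dependence of the mode with indices `l`, `m` and degree `d` on the coordinate `χ`. -/
def radialPart (d : ℕ) (l m : ℤ) (χ : ℝ) : ℝ :=
  Real.cos χ ^ l.natAbs * Real.sin χ ^ m.natAbs *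
    jacobi m.natAbs l.natAbs d (Real.cos (2 * χ))

theorem harm_toroidal (d : ℕ) (l m : ℤ) (χ θ φ : ℝ) :
    harm d l m (toroidal χ θ φ) =
      (radialPart d l m χ : ℂ) * Complex.exp ((l * θ + m * φ : ℝ) * Complex.I) := by
  have hz : zCoord (toroidal χ θ φ) = Complex.exp (θ * Complex.I) * (Real.cos χ : ℂ) := by
    rw [zCoord_apply, Complex.exp_mul_I, ← Complex.ofReal_cos, ← Complex.ofReal_sin]
    simp [toroidal]
    ring
  have hw : wCoord (toroidal χ θ φ) = Complex.exp (φ * Complex.I) * (Real.sin χ : ℂ) := by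
    rw [wCoord_apply, Complex.exp_mul_I, ← Complex.ofReal_cos, ← Complex.ofReal_sin]
    simp [toroidal]
    ring
  have ht : zSq (toroidal χ θ φ) = Real.cos χ ^ 2 := by
    simp [zSq, toroidal]
    linear_combination Real.cos χ ^ 2 * Real.sin_sq_add_cos_sq θ
  rw [harm_coe, hz, hw, signPow_exp_mul, signPow_exp_mul, signPow_ofReal, signPow_ofReal, ht,
    ← jacobi_eq_eval, ← Real.cos_two_mul, radialPart, Complex.ofReal_add, add_mul, Complex.exp_add]
  push_cast
  ring

theorem realHarm_toroidal_false (d : ℕ) (l m : ℤ) (χ θ φ : ℝ) :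
    realHarm false d l m (toroidal χ θ φ) =
      normFactor d l m * (radialPart d l m χ * Real.cos (l * θ + m * φ)) := by
  rw [realHarm, harm_toroidal, part_false, Complex.re_ofReal_mul, Complex.exp_ofReal_mul_I_re]

theorem realHarm_toroidal_true (d : ℕ) (l m : ℤ) (χ θ φ : ℝ) :
    realHarm true d l m (toroidal χ θ φ) =
      normFactor d l m * (radialPart d l m χ * Real.sin (l * θ + m * φ)) := by
  rw [realHarm, harm_toroidal, part_true, Complex.im_ofReal_mul, Complex.exp_ofReal_mul_I_im]

/-! ### Modes as harmonic polynomials -/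

theorem Admissible.degree_eq {k : ℕ} {l m : ℤ} (h : Admissible k l m) :
    k = l.natAbs + m.natAbs + 2 * deg k l m := by
  obtain ⟨h1, h2⟩ := h
  unfold Int.ModEq at h2
  rw [Int.abs_eq_natAbs, Int.abs_eq_natAbs] at h1
  unfold deg
  omega

/-- The quotient under the root in `psiNorm` is `harmNormSq` divided by `(2π)²`. -/
theorem sqrt_harmNormSq {k d : ℕ} {l m : ℤ} (hk : k = l.natAbs + m.natAbs + 2 * d)
    (hd : d = deg k l m) :
    psiNorm k l m = √(2 ^ ((if l = 0 then 1 else 0) + (if m = 0 then 1 else 0) : ℕ)) *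
      (√(harmNormSq m.natAbs l.natAbs d) / 2) := by
  rw [psiNorm, ← hd, mul_assoc]
  congr 1
  have : harmNormSq m.natAbs l.natAbs d = (2 * Real.pi) ^ 2 *
      (((l.natAbs + d).factorial * (m.natAbs + d).factorial : ℝ) /
        (2 * (k + 1) * d.factorial * (l.natAbs + m.natAbs + d).factorial)) := by
    have h : (k : ℝ) + 1 = m.natAbs + l.natAbs + 2 * d + 1 := by
      rw [hk]
      push_cast
      ring
    rw [h, harmNormSq]
    field_simp
  rw [this, Real.sqrt_mul (by positivity), Real.sqrt_sq (by positivity)]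
  ring

theorem normFactor_of_zero {k : ℕ} (h : Admissible k 0 0) :
    normFactor (deg k 0 0) 0 0 = (psiNorm k 0 0)⁻¹ := by
  rw [sqrt_harmNormSq h.degree_eq rfl, normFactor]
  simp only [and_self, if_true]
  rw [Real.sqrt_div zero_le_one, show (2 : ℝ) ^ (1 + 1) = 2 ^ 2 by norm_num,
    Real.sqrt_sq zero_le_two, Real.sqrt_one]
  field_simp

theorem normFactor_of_left {k : ℕ} {l : ℤ} (hl : l ≠ 0) (h : Admissible k l 0) :
    normFactor (deg k l 0) l 0 = (psiNorm k l 0)⁻¹ := by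
  rw [sqrt_harmNormSq h.degree_eq rfl, normFactor]
  simp only [hl, false_and, if_false, if_true, zero_add, pow_one]
  rw [Real.sqrt_div zero_le_two]
  have hN : √(harmNormSq (Int.natAbs 0) l.natAbs (deg k l 0)) ≠ 0 :=
    (Real.sqrt_pos.2 (harmNormSq_pos _ _ _)).ne'
  have h2 : √(2 : ℝ) * √2 = 2 := Real.mul_self_sqrt zero_le_two
  have h3 : √(2 : ℝ) ≠ 0 := by positivity
  field_simp
  linarith

theorem normFactor_of_right {k : ℕ} {m : ℤ} (hm : m ≠ 0) (h : Admissible k 0 m) :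
    normFactor (deg k 0 m) 0 m = (psiNorm k 0 m)⁻¹ := by
  rw [sqrt_harmNormSq h.degree_eq rfl, normFactor]
  simp only [hm, and_false, if_false, if_true, add_zero, pow_one]
  rw [Real.sqrt_div zero_le_two]
  have hN : √(harmNormSq m.natAbs (Int.natAbs 0) (deg k 0 m)) ≠ 0 :=
    (Real.sqrt_pos.2 (harmNormSq_pos _ _ _)).ne'
  have h2 : √(2 : ℝ) * √2 = 2 := Real.mul_self_sqrt zero_le_two
  have h3 : √(2 : ℝ) ≠ 0 := by positivity
  field_simp
  linarith

/-- The factor `√(1 / 2)` is the one in the four mixed families of modes. -/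
theorem normFactor_of_ne {k : ℕ} {l m : ℤ} (hl : l ≠ 0) (hm : m ≠ 0) (h : Admissible k l m) :
    normFactor (deg k l m) l m = √(1 / 2) * (psiNorm k l m)⁻¹ := by
  rw [sqrt_harmNormSq h.degree_eq rfl, normFactor]
  simp only [hl, hm, and_self, if_false, add_zero, pow_zero, Real.sqrt_one, one_mul]
  rw [Real.sqrt_div zero_le_two, Real.sqrt_div zero_le_one, Real.sqrt_one]
  have hN : √(harmNormSq m.natAbs l.natAbs (deg k l m)) ≠ 0 :=
    (Real.sqrt_pos.2 (harmNormSq_pos _ _ _)).ne'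
  have h2 : √(2 : ℝ) * √2 = 2 := Real.mul_self_sqrt zero_le_two
  have h3 : √(2 : ℝ) ≠ 0 := by positivity
  field_simp
  linarith

theorem normFactor_neg_right (d : ℕ) (l m : ℤ) : normFactor d l (-m) = normFactor d l m := by
  simp [normFactor]

theorem circ_of_nonneg {n : ℤ} (hn : 0 ≤ n) (t : ℝ) : circ n t = Real.cos (n * t) := by
  rw [circ, if_pos hn]
  congr 2
  rw [Nat.cast_natAbs, abs_of_nonneg hn]

theorem circ_neg_of_pos {n : ℤ} (hn : 0 < n) (t : ℝ) : circ (-n) t = Real.sin (n * t) := by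
  rw [circ, if_neg (by omega), Int.natAbs_neg]
  congr 2
  rw [Nat.cast_natAbs, abs_of_pos hn]

theorem psi_eq (k : ℕ) (l m : ℤ) (χ θ φ : ℝ) : psi k l m χ θ φ =
    (psiNorm k l m)⁻¹ * (radialPart (deg k l m) l m χ * (circ l θ * circ m φ)) := by
  rw [psi, psiTilde, radialPart, div_eq_inv_mul]
  ring

theorem deg_neg_left (k : ℕ) (l m : ℤ) : deg k (-l) m = deg k l m := by simp [deg]

theorem deg_neg_right (k : ℕ) (l m : ℤ) : deg k l (-m) = deg k l m := by simp [deg]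

theorem psiNorm_neg_left (k : ℕ) (l m : ℤ) : psiNorm k (-l) m = psiNorm k l m := by
  simp [psiNorm, deg_neg_left]

theorem psiNorm_neg_right (k : ℕ) (l m : ℤ) : psiNorm k l (-m) = psiNorm k l m := by
  simp [psiNorm, deg_neg_right]

theorem radialPart_neg_left (d : ℕ) (l m : ℤ) (χ : ℝ) :
    radialPart d (-l) m χ = radialPart d l m χ := by simp [radialPart]

theorem radialPart_neg_right (d : ℕ) (l m : ℤ) (χ : ℝ) :
    radialPart d l (-m) χ = radialPart d l m χ := by simp [radialPart]

theorem Admissible.neg_left {k : ℕ} {l m : ℤ} (h : Admissible k l m) : Admissible k (-l) m := by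
  obtain ⟨h1, h2⟩ := h
  unfold Int.ModEq at h2
  refine ⟨by rwa [abs_neg], ?_⟩
  unfold Int.ModEq
  omega

theorem Admissible.neg_right {k : ℕ} {l m : ℤ} (h : Admissible k l m) : Admissible k l (-m) := by
  obtain ⟨h1, h2⟩ := h
  unfold Int.ModEq at h2
  refine ⟨by rwa [abs_neg], ?_⟩
  unfold Int.ModEq
  omega

theorem admissible_of_degree_eq {k d : ℕ} {l m : ℤ} (h : k = l.natAbs + m.natAbs + 2 * d) :
    Admissible k l m := by
  refine ⟨by rw [Int.abs_eq_natAbs, Int.abs_eq_natAbs]; omega, ?_⟩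
  unfold Int.ModEq
  omega

theorem Admissible.abs_left {k : ℕ} {l m : ℤ} (h : Admissible k l m) :
    Admissible k |l| m := by
  rcases abs_choice l with h' | h' <;> rw [h']
  exacts [h, h.neg_left]

theorem Admissible.abs_right {k : ℕ} {l m : ℤ} (h : Admissible k l m) :
    Admissible k l |m| := by
  rcases abs_choice m with h' | h' <;> rw [h']
  exacts [h, h.neg_right]

namespace Mode

variable {p : ℕ} {q : ℤ} {k : ℕ}

/-- The weight in `θ` of the harmonic polynomial that gives the mode. -/
def lWeight : Mode p q k → ℤ
  | .zero _ => 0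
  | .lMode l _ _ _ => |l|
  | .mMode _ _ _ _ => 0
  | .e1 l _ _ _ _ _ => l
  | .e2 l _ _ _ _ _ => l
  | .e3 l _ _ _ _ _ => l
  | .e4 l _ _ _ _ _ => l

/-- The weight in `φ` of the harmonic polynomial that gives the mode. -/
def mWeight : Mode p q k → ℤ
  | .zero _ => 0
  | .lMode _ _ _ _ => 0
  | .mMode m _ _ _ => |m|
  | .e1 _ m _ _ _ _ => -m
  | .e2 _ m _ _ _ _ => -m
  | .e3 _ m _ _ _ _ => m
  | .e4 _ m _ _ _ _ => m

/-- Whether the mode is an imaginary part. -/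
def isIm : Mode p q k → Bool
  | .zero _ => false
  | .lMode l _ _ _ => decide (l < 0)
  | .mMode m _ _ _ => decide (m < 0)
  | .e1 _ _ _ _ _ _ => false
  | .e2 _ _ _ _ _ _ => true
  | .e3 _ _ _ _ _ _ => false
  | .e4 _ _ _ _ _ _ => true

theorem isHalf (i : Mode p q k) : IsHalf i.lWeight i.mWeight := by
  unfold IsHalf
  cases i <;> simp only [lWeight, mWeight] <;> grind

theorem ne_zero_of_isIm (i : Mode p q k) (h : i.isIm = true) :
    i.lWeight ≠ 0 ∨ i.mWeight ≠ 0 := by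
  cases i <;> simp only [lWeight, mWeight, isIm] at h ⊢ <;> grind

theorem admissible (i : Mode p q k) : Admissible k i.lWeight i.mWeight := by
  cases i with
  | zero h => exact h
  | lMode l hl h hc => exact h.abs_left
  | mMode m hm h hc => exact h.abs_right
  | e1 l m hl hm h hc => exact h.neg_right
  | e2 l m hl hm h hc => exact h.neg_right
  | e3 l m hl hm h hc => exact h
  | e4 l m hl hm h hc => exact h

theorem dvd_weight (i : Mode p q k) : (p : ℤ) ∣ i.lWeight + q * i.mWeight := by
  cases i with
  | zero h => simp [lWeight, mWeight]
  | lMode l hl h hc => simpa [lWeight, mWeight] using hc.dvd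
  | mMode m hm h hc =>
    have := Int.modEq_zero_iff_dvd.1 hc
    rcases abs_choice m with h' | h' <;> simpa [lWeight, mWeight, h'] using this
  | e1 l m hl hm h hc =>
    have := Int.modEq_iff_dvd.1 hc.symm
    simpa [lWeight, mWeight, sub_eq_add_neg] using this
  | e2 l m hl hm h hc =>
    have := Int.modEq_iff_dvd.1 hc.symm
    simpa [lWeight, mWeight, sub_eq_add_neg] using this
  | e3 l m hl hm h hc =>
    have := Int.modEq_iff_dvd.1 hc.symm
    simpa [lWeight, mWeight, sub_eq_add_neg] using this
  | e4 l m hl hm h hc =>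
    have := Int.modEq_iff_dvd.1 hc.symm
    simpa [lWeight, mWeight, sub_eq_add_neg] using this

theorem weight_injective {i j : Mode p q k} (h1 : i.isIm = j.isIm) (h2 : i.lWeight = j.lWeight)
    (h3 : i.mWeight = j.mWeight) : i = j := by
  cases i <;> cases j <;> simp only [lWeight, mWeight, isIm] at h1 h2 h3 <;> grind

instance : Finite (Mode p q k) := by
  let S : Set ℤ := Set.Icc (-(k : ℤ)) k
  have : Finite S := (Set.finite_Icc _ _).to_subtype
  have hb : ∀ i : Mode p q k, i.lWeight ∈ S ∧ i.mWeight ∈ S := fun i => by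
    have := i.admissible.1
    rw [Int.abs_eq_natAbs, Int.abs_eq_natAbs] at this
    simp only [S, Set.mem_Icc]
    omega
  refine Finite.of_injective
    (fun i : Mode p q k => (i.isIm, (⟨i.lWeight, (hb i).1⟩ : S), (⟨i.mWeight, (hb i).2⟩ : S))) ?_
  intro i j h
  simp only [Prod.mk.injEq, Subtype.mk.injEq] at h
  exact weight_injective h.1 h.2.1 h.2.2

/-- The families of modes correspond to the regions of the half plane: `m < 0`, `m = 0` and `m > 0`
for `l > 0`, and the half line `l = 0`. The choice of part selects the sign of the index or the
member of the pair. The imaginary part of weight zero is excluded, as it is the zero function. -/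
theorem exists_of_weight {l m : ℤ} (h : Admissible k l m) (hh : IsHalf l m)
    (hd : (p : ℤ) ∣ l + q * m) {s : Bool} (hs : s = true → l ≠ 0 ∨ m ≠ 0) :
    ∃ i : Mode p q k, i.isIm = s ∧ i.lWeight = l ∧ i.mWeight = m := by
  rcases hh with hl | ⟨rfl, hm⟩
  · rcases lt_trichotomy m 0 with hm | rfl | hm
    · have hc : l ≡ q * -m [ZMOD p] := (Int.modEq_iff_dvd.2 (by simpa using hd)).symm
      cases s
      · exact ⟨.e1 l (-m) hl (by omega) h.neg_right hc, by simp [isIm, lWeight, mWeight]⟩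
      · exact ⟨.e2 l (-m) hl (by omega) h.neg_right hc, by simp [isIm, lWeight, mWeight]⟩
    · rw [mul_zero, add_zero] at hd
      have hc : l ≡ 0 [ZMOD p] := Int.modEq_zero_iff_dvd.2 hd
      cases s
      · exact ⟨.lMode l hl.ne' h hc, by simp [isIm, lWeight, mWeight, abs_of_pos hl, hl.le]⟩
      · exact ⟨.lMode (-l) (by omega) h.neg_left (by simpa using hc.neg),
          by simp [isIm, lWeight, mWeight, abs_of_pos hl, hl]⟩
    · have hc : l ≡ -(q * m) [ZMOD p] := (Int.modEq_iff_dvd.2 (by simpa using hd)).symm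
      cases s
      · exact ⟨.e3 l m hl hm h hc, by simp [isIm, lWeight, mWeight]⟩
      · exact ⟨.e4 l m hl hm h hc, by simp [isIm, lWeight, mWeight]⟩
  · rcases hm.eq_or_lt with rfl | hm
    · cases s
      · exact ⟨.zero h, by simp [isIm, lWeight, mWeight]⟩
      · simp at hs
    · rw [zero_add] at hd
      have hc : q * m ≡ 0 [ZMOD p] := Int.modEq_zero_iff_dvd.2 hd
      cases s
      · exact ⟨.mMode m hm.ne' h hc, by simp [isIm, lWeight, mWeight, abs_of_pos hm, hm.le]⟩
      · exact ⟨.mMode (-m) (by omega) h.neg_right (by simpa using hc.neg),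
          by simp [isIm, lWeight, mWeight, abs_of_pos hm, hm]⟩

/-- The mode as a function on the 3-sphere. -/
def sphereFun (i : Mode p q k) : S3 → ℝ :=
  realHarm i.isIm (deg k i.lWeight i.mWeight) i.lWeight i.mWeight

/-- The mixed modes are the expansions of `cos(lθ ∓ mφ)` and `sin(lθ ∓ mφ)`; a sine factor is a
`circ` of negative index. -/
theorem sphereFun_toroidal (i : Mode p q k) (χ θ φ : ℝ) :
    i.sphereFun (toroidal χ θ φ) = i.toFun χ θ φ := by
  have h0 : ∀ t, circ 0 t = 1 := fun t => by simp [circ]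
  cases i with
  | zero h =>
    simp only [sphereFun, isIm, lWeight, mWeight, toFun, realHarm_toroidal_false, psi_eq, h0,
      normFactor_of_zero h]
    simp
  | lMode l hl h hc =>
    rcases hl.lt_or_gt with hl' | hl'
    · obtain ⟨n, rfl⟩ : ∃ n, l = -n := ⟨-l, by ring⟩
      have hn : 0 < n := by omega
      have h' : Admissible k n 0 := by simpa using h.neg_left
      simp only [sphereFun, isIm, lWeight, mWeight, toFun, hl', decide_true, abs_neg, abs_of_pos hn,
        realHarm_toroidal_true, psi_eq, h0, psiNorm_neg_left, radialPart_neg_left, deg_neg_left,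
        circ_neg_of_pos hn, normFactor_of_left hn.ne' h']
      simp
    · simp only [sphereFun, isIm, lWeight, mWeight, toFun, hl'.not_gt, decide_false,
        abs_of_pos hl', realHarm_toroidal_false, psi_eq, h0, circ_of_nonneg hl'.le,
        normFactor_of_left hl h]
      simp
  | mMode m hm h hc =>
    rcases hm.lt_or_gt with hm' | hm'
    · obtain ⟨n, rfl⟩ : ∃ n, m = -n := ⟨-m, by ring⟩
      have hn : 0 < n := by omega
      have h' : Admissible k 0 n := by simpa using h.neg_right
      simp only [sphereFun, isIm, lWeight, mWeight, toFun, hm', decide_true, abs_neg, abs_of_pos hn,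
        realHarm_toroidal_true, psi_eq, h0, psiNorm_neg_right, radialPart_neg_right, deg_neg_right,
        circ_neg_of_pos hn, normFactor_of_right hn.ne' h']
      simp
    · simp only [sphereFun, isIm, lWeight, mWeight, toFun, hm'.not_gt, decide_false,
        abs_of_pos hm', realHarm_toroidal_false, psi_eq, h0, circ_of_nonneg hm'.le,
        normFactor_of_right hm h]
      simp
  | e1 l m hl hm h hc =>
    simp only [sphereFun, isIm, lWeight, mWeight, toFun, realHarm_toroidal_false, psi_eq,
      circ_of_nonneg hl.le, circ_of_nonneg hm.le, circ_neg_of_pos hl, circ_neg_of_pos hm,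
      normFactor_neg_right, normFactor_of_ne hl.ne' hm.ne' h, psiNorm_neg_left,
      psiNorm_neg_right, deg_neg_left, deg_neg_right, radialPart_neg_left, radialPart_neg_right]
    push_cast
    rw [neg_mul, Real.cos_add, Real.cos_neg, Real.sin_neg]
    ring
  | e2 l m hl hm h hc =>
    simp only [sphereFun, isIm, lWeight, mWeight, toFun, realHarm_toroidal_true, psi_eq,
      circ_of_nonneg hl.le, circ_of_nonneg hm.le, circ_neg_of_pos hl, circ_neg_of_pos hm,
      normFactor_neg_right, normFactor_of_ne hl.ne' hm.ne' h, psiNorm_neg_left,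
      psiNorm_neg_right, deg_neg_left, deg_neg_right, radialPart_neg_left, radialPart_neg_right]
    push_cast
    rw [neg_mul, Real.sin_add, Real.cos_neg, Real.sin_neg]
    ring
  | e3 l m hl hm h hc =>
    simp only [sphereFun, isIm, lWeight, mWeight, toFun, realHarm_toroidal_false, psi_eq,
      circ_of_nonneg hl.le, circ_of_nonneg hm.le, circ_neg_of_pos hl, circ_neg_of_pos hm,
      normFactor_of_ne hl.ne' hm.ne' h, psiNorm_neg_left,
      psiNorm_neg_right, deg_neg_left, deg_neg_right, radialPart_neg_left, radialPart_neg_right]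
    rw [Real.cos_add]
    ring
  | e4 l m hl hm h hc =>
    simp only [sphereFun, isIm, lWeight, mWeight, toFun, realHarm_toroidal_true, psi_eq,
      circ_of_nonneg hl.le, circ_of_nonneg hm.le, circ_neg_of_pos hl, circ_neg_of_pos hm,
      normFactor_of_ne hl.ne' hm.ne' h, psiNorm_neg_left,
      psiNorm_neg_right, deg_neg_left, deg_neg_right, radialPart_neg_left, radialPart_neg_right]
    rw [Real.sin_add]
    ring

theorem isSmooth3_sphereFun (i : Mode p q k) : IsSmooth3 i.sphereFun := isSmooth3_realHarm _ _ _ _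

theorem sphereLaplacian_sphereFun (i : Mode p q k) (x : S3) :
    sphereLaplacian i.sphereFun x = -((k : ℝ) * (k + 2)) * i.sphereFun x :=
  sphereLaplacian_realHarm _ _ _ _ i.admissible.degree_eq x

theorem integral_sphereFun_sq (i : Mode p q k) :
    ∫ x, i.sphereFun x * i.sphereFun x ∂vol3 = 1 :=
  integral_realHarm_sq _ i.ne_zero_of_isIm

theorem integral_sphereFun_mul {i j : Mode p q k} (h : i ≠ j) :
    ∫ x, i.sphereFun x * j.sphereFun x ∂vol3 = 0 :=
  integral_realHarm_eq_zero i.isHalf j.isHalf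
    (i.admissible.degree_eq.symm.trans j.admissible.degree_eq) i.ne_zero_of_isIm j.ne_zero_of_isIm
    fun ⟨h1, h2, h3⟩ => h (weight_injective h1 h2 h3)

end Mode

/-! ### Modes on the lens space -/

/-- The angle is `2π(l + qm)/p`. -/
theorem exp_weight_eq_one_iff {p : ℕ} (hp : 0 < p) (q l m : ℤ) :
    Complex.exp ((l * (2 * Real.pi / p) + m * (2 * Real.pi * q / p) : ℝ) * Complex.I) = 1 ↔
      (p : ℤ) ∣ l + q * m := by
  have hp' : (p : ℂ) ≠ 0 := by exact_mod_cast hp.ne'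
  have hpi : (2 * Real.pi * Complex.I : ℂ) ≠ 0 := Complex.two_pi_I_ne_zero
  have he : ((l * (2 * Real.pi / p) + m * (2 * Real.pi * q / p) : ℝ) : ℂ) * Complex.I =
      ((l + q * m : ℤ) : ℂ) / p * (2 * Real.pi * Complex.I) := by
    push_cast
    field_simp
  rw [he, Complex.exp_eq_one_iff]
  constructor
  · rintro ⟨n, hn⟩
    refine ⟨n, ?_⟩
    have h := mul_right_cancel₀ hpi hn
    rw [div_eq_iff hp'] at h
    have h' : l + q * m = n * p := by exact_mod_cast h
    rw [h', mul_comm]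
  · rintro ⟨n, hn⟩
    refine ⟨n, ?_⟩
    rw [hn]
    push_cast
    field_simp

theorem harm_gen (p : ℕ) (q : ℤ) (d : ℕ) (l m : ℤ) (x : S3) : harm d l m (gen p q x) =
    Complex.exp ((l * (2 * Real.pi / p) + m * (2 * Real.pi * q / p) : ℝ) * Complex.I) *
      harm d l m x :=
  harm_rot d l m _ _ x

theorem eq_of_orbitRel {p : ℕ} {q : ℤ} {F : S3 → ℝ} (hF : ∀ x, F (gen p q x) = F x) (x y : S3)
    (h : (MulAction.orbitRel (Subgroup.zpowers (gen p q)) S3).r x y) : F x = F y := by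
  have key : Subgroup.zpowers (gen p q) ≤
      { carrier := {s : Equiv.Perm S3 | ∀ x, F (s x) = F x}
        mul_mem' := fun {s t} hs ht x => (hs (t x)).trans (ht x)
        one_mem' := fun x => rfl
        inv_mem' := fun {s} hs x => by
          have := hs (s.symm x)
          rwa [Equiv.apply_symm_apply, eq_comm] at this } := by
    rw [Subgroup.zpowers_le]
    exact hF
  obtain ⟨⟨s, hs⟩, rfl⟩ := h
  exact key hs y

variable {p : ℕ} {q : ℤ} {k : ℕ}

theorem Mode.sphereFun_gen (hp : 0 < p) (i : Mode p q k) (x : S3) :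
    i.sphereFun (gen p q x) = i.sphereFun x := by
  rw [sphereFun, realHarm, realHarm, harm_gen, (exp_weight_eq_one_iff hp _ _ _).2 i.dvd_weight,
    one_mul]

/-- The mode as a function on the lens space. -/
def Mode.lensFun (hp : 0 < p) (i : Mode p q k) : Lens p q → ℝ :=
  Quotient.lift i.sphereFun (eq_of_orbitRel (i.sphereFun_gen hp))

theorem Mode.lensFun_mem (hp : 0 < p) (i : Mode p q k) :
    i.lensFun hp ∈ eigenspace p q (-((k : ℝ) * (k + 2))) := by
  refine ⟨i.isSmooth3_sphereFun, ?_⟩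
  rintro ⟨x⟩
  exact i.sphereLaplacian_sphereFun x

theorem sphereLaplacian_lift_of_mem {c : ℝ} {f : Lens p q → ℝ} (hf : f ∈ eigenspace p q c)
    (x : S3) : sphereLaplacian (lift f) x = c * lift f x :=
  hf.2 (proj p q x)

/-! ### Completeness -/

theorem integral_lift_mul_harm_eq_zero (hp : 0 < p) {f : Lens p q → ℝ} (d : ℕ) {l m : ℤ}
    (h : ¬ (p : ℤ) ∣ l + q * m) : ∫ x : S3, (lift f x : ℂ) * harm d l m x ∂vol3 = 0 := by
  have h1 := integral_spherePerm (rot (2 * Real.pi / p) (2 * Real.pi * q / p))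
    fun x : S3 => (lift f x : ℂ) * harm d l m x
  set e := Complex.exp ((l * (2 * Real.pi / p) + m * (2 * Real.pi * q / p) : ℝ) * Complex.I)
  have h2 : ∀ x : S3, (lift f (gen p q x) : ℂ) * harm d l m (gen p q x) =
      e * ((lift f x : ℂ) * harm d l m x) := fun x => by
    rw [lift_gen, harm_gen]
    ring
  have h3 : e * ∫ x : S3, (lift f x : ℂ) * harm d l m x ∂vol3 =
      ∫ x : S3, (lift f x : ℂ) * harm d l m x ∂vol3 := by
    rw [← integral_const_mul, ← integral_congr_ae (.of_forall h2)]
    exact h1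
  have he : e - 1 ≠ 0 := sub_ne_zero.2 fun he => h ((exp_weight_eq_one_iff hp q l m).1 he)
  have h4 : (e - 1) * ∫ x : S3, (lift f x : ℂ) * harm d l m x ∂vol3 = 0 := by
    rw [sub_mul, h3, one_mul, sub_self]
  exact (mul_eq_zero.1 h4).resolve_left he

/-- Only harmonic polynomials with the same eigenvalue and an invariant weight need testing: the
others are orthogonal to `f` by symmetry of the Laplacian or by invariance under the generator. -/
theorem eq_zero_of_mem_eigenspace (hp : 0 < p) {c : ℝ} {f : Lens p q → ℝ}
    (hf : f ∈ eigenspace p q c)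
    (h : ∀ (d : ℕ) (l m : ℤ) (k : ℕ), k = l.natAbs + m.natAbs + 2 * d → c = -((k : ℝ) * (k + 2)) →
      (p : ℤ) ∣ l + q * m → ∫ x : S3, (lift f x : ℂ) * harm d l m x ∂vol3 = 0) : f = 0 := by
  have h0 : lift f = 0 := by
    refine eq_zero_of_integral_mul_harm_eq_zero (continuous_of_isSmooth3 hf.1) fun d l m => ?_
    by_cases hd : (p : ℤ) ∣ l + q * m
    · by_cases hc : c = -(((l.natAbs + m.natAbs + 2 * d : ℕ) : ℝ) *
          ((l.natAbs + m.natAbs + 2 * d : ℕ) + 2))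
      · exact h d l m _ rfl hc hd
      · exact integral_mul_harm_eq_zero hf.1 (sphereLaplacian_lift_of_mem hf) d l m rfl hc
    · exact integral_lift_mul_harm_eq_zero hp d hd
  funext x
  induction x using Quotient.inductionOn with
  | h x => exact congrFun h0 x

theorem integral_mul_part_harm_eq_zero {F : S3 → ℝ}
    (h : ∀ i : Mode p q k, ∫ x, F x * i.sphereFun x ∂vol3 = 0) {d : ℕ} {l m : ℤ}
    (hk : k = l.natAbs + m.natAbs + 2 * d) (hh : IsHalf l m) (hd : (p : ℤ) ∣ l + q * m)
    (s : Bool) : ∫ x : S3, F x * part s (harm d l m x) ∂vol3 = 0 := by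
  -- The imaginary part in weight zero belongs to no mode, but it is identically zero.
  by_cases hs : s = true → l ≠ 0 ∨ m ≠ 0
  · obtain ⟨i, rfl, rfl, rfl⟩ :=
      Mode.exists_of_weight (p := p) (q := q) (admissible_of_degree_eq hk) hh hd hs
    have hdeg : deg k i.lWeight i.mWeight = d := by
      have := i.admissible.degree_eq
      omega
    have hi := h i
    simp only [Mode.sphereFun, realHarm, hdeg] at hi
    have : ∀ x : S3, F x * (normFactor d i.lWeight i.mWeight *
        part i.isIm (harm d i.lWeight i.mWeight x)) = normFactor d i.lWeight i.mWeight *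
          (F x * part i.isIm (harm d i.lWeight i.mWeight x)) := fun x => by ring
    rw [integral_congr_ae (.of_forall this), integral_const_mul] at hi
    exact (mul_eq_zero.1 hi).resolve_left (normFactor_pos _ _ _).ne'
  · push Not at hs
    obtain ⟨rfl, rfl, rfl⟩ := hs
    simp [part_true_harm_zero]

theorem integral_mul_harm_eq_zero_of_modes {F : S3 → ℝ} (hF : Continuous F)
    (h : ∀ i : Mode p q k, ∫ x, F x * i.sphereFun x ∂vol3 = 0) {d : ℕ} {l m : ℤ}
    (hk : k = l.natAbs + m.natAbs + 2 * d) (hd : (p : ℤ) ∣ l + q * m) :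
    ∫ x : S3, (F x : ℂ) * harm d l m x ∂vol3 = 0 := by
  have half : ∀ l m : ℤ, k = l.natAbs + m.natAbs + 2 * d → IsHalf l m → (p : ℤ) ∣ l + q * m →
      ∫ x : S3, (F x : ℂ) * harm d l m x ∂vol3 = 0 := by
    intro l m hk hh hd
    have hi : Integrable (fun x : S3 => (F x : ℂ) * harm d l m x) vol3 :=
      integrable_vol3 ((Complex.continuous_ofReal.comp hF).mul (continuous_harm d l m))
    have key : ∀ s, part s (∫ x : S3, (F x : ℂ) * harm d l m x ∂vol3) = 0 := fun s => by
      rw [← (part s).integral_comp_comm hi, ← integral_mul_part_harm_eq_zero h hk hh hd s]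
      refine integral_congr_ae (.of_forall fun x => ?_)
      simp only
      rw [← Complex.real_smul, map_smul, smul_eq_mul]
    exact Complex.ext (key false) (key true)
  by_cases hh : IsHalf l m
  · exact half l m hk hh hd
  -- Outside the half plane the opposite weight lies inside it, and the integral is the conjugate of
  -- that one because `F` is real.
  · have hn := half (-l) (-m) (by simpa using hk) (by unfold IsHalf at hh ⊢; omega)
      (by rw [mul_neg, ← neg_add, dvd_neg]; exact hd)
    have hc := congrArg conj hn
    rw [← integral_conj, map_zero] at hc
    rw [← hc]
    refine integral_congr_ae (.of_forall fun x => ?_)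
    simp only [harm_neg, map_mul, Complex.conj_conj, Complex.conj_ofReal]

/-! ### The eigenbasis -/

/-- Integration against a mode, as a linear form on the eigenspace. -/
def Mode.pairing (i : Mode p q k) (c : ℝ) : eigenspace p q c →ₗ[ℝ] ℝ where
  toFun f := ∫ x, lift (f : Lens p q → ℝ) x * i.sphereFun x ∂vol3
  map_add' f g := by
    have hi : ∀ f : eigenspace p q c,
        Integrable (fun x => lift (f : Lens p q → ℝ) x * i.sphereFun x) vol3 := fun f =>
      integrable_vol3 ((continuous_of_isSmooth3 f.2.1).mul
        (continuous_of_isSmooth3 i.isSmooth3_sphereFun))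
    rw [← integral_add (hi f) (hi g)]
    refine integral_congr_ae (.of_forall fun x => ?_)
    simp only [lift, Submodule.coe_add, Pi.add_apply]
    ring
  map_smul' r f := by
    rw [RingHom.id_apply, smul_eq_mul, ← integral_const_mul]
    refine integral_congr_ae (.of_forall fun x => ?_)
    simp only [lift, Submodule.coe_smul, Pi.smul_apply, smul_eq_mul]
    ring

/-- The mode as an element of its eigenspace. -/
def Mode.eigenvector (hp : 0 < p) (i : Mode p q k) : eigenspace p q (-((k : ℝ) * (k + 2))) :=
  ⟨i.lensFun hp, i.lensFun_mem hp⟩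

theorem Mode.pairing_eigenvector_self (hp : 0 < p) (i : Mode p q k) :
    i.pairing _ (i.eigenvector hp) = 1 :=
  i.integral_sphereFun_sq

theorem Mode.pairing_eigenvector_of_ne (hp : 0 < p) {i j : Mode p q k} (h : j ≠ i) :
    i.pairing _ (j.eigenvector hp) = 0 :=
  integral_sphereFun_mul h

theorem linearIndependent_eigenvector (hp : 0 < p) :
    LinearIndependent ℝ fun i : Mode p q k => i.eigenvector hp := by
  rw [linearIndependent_iff']
  intro s g hg i hi
  have h := congrArg (i.pairing _) hg
  rw [map_sum, map_zero, Finset.sum_eq_single i] at h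
  · simpa [Mode.pairing_eigenvector_self] using h
  · intro j _ hj
    rw [map_smul, Mode.pairing_eigenvector_of_ne hp hj, smul_zero]
  · exact fun h => absurd hi h

theorem span_eigenvector (hp : 0 < p) :
    ⊤ ≤ Submodule.span ℝ (Set.range fun i : Mode p q k => i.eigenvector hp) := by
  intro f _
  have : Fintype (Mode p q k) := Fintype.ofFinite _
  -- The remainder after orthogonal projection is orthogonal to every mode of its own eigenvalue,
  -- hence zero.
  set g := f - ∑ i : Mode p q k, i.pairing _ f • i.eigenvector hp with hg
  have hg0 : ∀ i : Mode p q k, i.pairing _ g = 0 := fun i => by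
    rw [hg, map_sub, map_sum, Finset.sum_eq_single i]
    · rw [map_smul, Mode.pairing_eigenvector_self, smul_eq_mul, mul_one, sub_self]
    · intro j _ hj
      rw [map_smul, Mode.pairing_eigenvector_of_ne hp hj, smul_zero]
    · exact fun h => absurd (Finset.mem_univ i) h
  have hz : (g : Lens p q → ℝ) = 0 := by
    refine eq_zero_of_mem_eigenspace hp g.2 fun d l m k' hk' hc hd => ?_
    obtain rfl := eigenvalue_injective hc
    exact integral_mul_harm_eq_zero_of_modes (continuous_of_isSmooth3 g.2.1) hg0 hk' hd
  have hf : f = ∑ i : Mode p q k, i.pairing _ f • i.eigenvector hp :=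
    sub_eq_zero.1 (Subtype.ext hz)
  rw [hf]
  exact Submodule.sum_mem _ fun i _ => Submodule.smul_mem _ _ (Submodule.subset_span ⟨i, rfl⟩)

end LensSpace

end

theorem theorem2 (p : ℕ) (hp : 0 < p) (q : ℤ) :
    (∀ c : ℝ, LensSpace.eigenspace p q c ≠ ⊥ → ∃ k : ℕ, c = -((k : ℝ) * (k + 2))) ∧
    ∀ k : ℕ, ∃ b : Module.Basis (LensSpace.Mode p q k) ℝ
        (LensSpace.eigenspace p q (-((k : ℝ) * (k + 2)))),
      (∀ i, LensSpace.lensInner (b i : LensSpace.Lens p q → ℝ) (b i) = 1) ∧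
      (∀ i j, i ≠ j → LensSpace.lensInner (b i : LensSpace.Lens p q → ℝ) (b j) = 0) ∧
      (∀ i, ∀ χ ∈ Set.Icc (0 : ℝ) (Real.pi / 2), ∀ θ φ : ℝ,
        LensSpace.lift (b i : LensSpace.Lens p q → ℝ) (LensSpace.toroidal χ θ φ) =
          i.toFun χ θ φ) := by
  refine ⟨fun c hc => ?_, fun k => ?_⟩
  · by_contra hk
    refine hc ((Submodule.eq_bot_iff _).2 fun f hf => ?_)
    -- Since `c` is no `-k(k+2)`, the test condition is vacuous.
    exact LensSpace.eq_zero_of_mem_eigenspace hp hf fun _ _ _ k _ h => absurd ⟨k, h⟩ hk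
  · refine ⟨Module.Basis.mk (LensSpace.linearIndependent_eigenvector hp)
      (LensSpace.span_eigenvector hp), fun i => ?_, fun i j hij => ?_, fun i χ _ θ φ => ?_⟩
    · rw [Module.Basis.mk_apply]
      exact i.integral_sphereFun_sq
    · rw [Module.Basis.mk_apply, Module.Basis.mk_apply]
      exact LensSpace.Mode.integral_sphereFun_mul hij
    · rw [Module.Basis.mk_apply]
      exact i.sphereFun_toroidal χ θ φ
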